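/- \textbf{Setting.} Let $\mu>0$ and $0<\beta<\sqrt{\mu}$, and let $f:\mathbb{R}\to[0,1]$ be measurable with $f(x)+f(-x)\le 1$ for all $x$. The optical mode is $\mathcal{H}_C=L^2(\mathbb{R})$, where $\langle x|$ evaluates the wave function at $x$. The $n$-photon state has wave function $(2/\pi)^{1/4}(n!)^{-1/2}\mathrm{He}_n(2x)e^{-x^2}$ (with $\mathrm{He}_n$ the probabilists' Hermite polynomial), and the coherent state $|b\rangle$, $b\in\mathbb{R}$, has wave function $(2/\pi)^{1/4}e^{-(x-b)^2}$. $\Pi_{\rm ev}$ and $\Pi_{\rm od}$ are the projections onto the closed spans of the even and of the odd photon-number states. $A$ and $B$ are qubits with basis $|0\rangle,|1\rangle$, $|\pm\rangle=(|0\rangle\pm|1\rangle)/\sqrt2$, Pauli matrix $X$, and $\text{C-}X_{BA}=|0\rangle\langle0|_B\otimes I_A+|1\rangle\langle1|_B\otimes X_A$. All operator integrals are meant weakly, i.e. through their matrix elements. \textbf{Phase error operator.} Let $q=(1-e^{-2(\mu-\beta^2)})/2$, let $g_{m,V}$ be the density of the normal law with mean $m$ and variance $V$, put $v_\pm(x)=\sqrt{g_{\beta,1/4}(x)}\,|0\rangle\pm\sqrt{g_{-\beta,1/4}(x)}\,|1\rangle$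 and $$\tau_{AB}(x)=(1-q)\,|v_+(x)\rangle\langle v_+(x)|_A\otimes|+\rangle\langle+|_B+q\,|v_-(x)\rangle\langle v_-(x)|_A\otimes|-\rangle\langle-|_B .$$ The Hermitian matrix $\langle0|_B\tau_{AB}(x)|1\rangle_B$ has one positive and one negative eigenvalue; let $u_+(x),u_-(x)$ be corresponding unit eigenvectors and $W(x)=|u_+(x)\rangle\langle u_+(x)|-|u_-(x)\rangle\langle u_-(x)|$. Put $V(x)=\bigl(|0\rangle\langle0|_B\otimes I_A+|1\rangle\langle1|_B\otimes W(x)_A\bigr)\,\text{C-}X_{BA}$, $K(x)=\sqrt{f(x)}\,(|0\rangle_B\langle x|_C+|1\rangle_B\langle -x|_C)$, and $$M^{\rm hom}_{\rm ph}=\int_{-\infty}^{\infty}dx\,[I_A\otimes K(x)^\dagger]\,V(x)^\dagger\,(I_A\otimes|-\rangle\langle-|_B)\,V(x)\,[I_A\otimes K(x)]$$ on $\mathbb{C}^2_A\otimes\mathcal{H}_C$. Further let $\Pi^{\rm fid}=|0\rangle\langle0|_A\otimes|\beta\rangle\langle\beta|+|1\rangle\langle1|_A\otimes|{-\beta}\rangle\langle{-\beta}|$,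 $\Pi^{\rm trash}_-=|-\rangle\langle-|_A\otimes I_C$, and $M^{\rm hom}[\kappa,\gamma]=M^{\rm hom}_{\rm ph}+\kappa\,\Pi^{\rm fid}-\gamma\,\Pi^{\rm trash}_-$. \textbf{Parameters.} Let $\theta(x)$ be defined by $|\theta(x)|\le\pi/2$ and $\tan\theta(x)=e^{-2(\mu-\beta^2)}\sinh(4\beta x)$. Put $$M_{\rm oo}=\int f(x)[1+\cos\theta(x)]\,\Pi_{\rm od}|x\rangle\langle x|\Pi_{\rm od}\,dx,\quad M_{\rm ee}=\int f(x)[1-\cos\theta(x)]\,\Pi_{\rm ev}|x\rangle\langle x|\Pi_{\rm ev}\,dx,$$ $$M_{\rm oe}=\int f(x)\sin\theta(x)\,\Pi_{\rm od}|x\rangle\langle x|\Pi_{\rm ev}\,dx,\qquad M'_{\rm oe}=\int -f(x)\sin\theta(x)\,\Pi_{\rm od}|x\rangle\langle x|\Pi_{\rm ev}\,dx,$$ $M_{\rm eo}=M_{\rm oe}^\dagger$, and $$C_{\rm o}=\langle\beta|\Pi_{\rm od}|\beta\rangle,\quad C_{\rm e}=\langle\beta|\Pi_{\rm ev}|\beta\rangle,\quad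 \lambda_{\rm oo}=C_{\rm o}^{-1}\langle\beta|M_{\rm oo}|\beta\rangle,\quad \lambda_{\rm ee}=C_{\rm e}^{-1}\langle\beta|M_{\rm ee}|\beta\rangle,\quad \lambda_{\rm oe}=(C_{\rm o}C_{\rm e})^{-1/2}\langle\beta|M_{\rm oe}|\beta\rangle,$$ $$\sigma_{\rm oo}=\bigl(C_{\rm o}^{-1}\|M_{\rm oo}|\beta\rangle\|^2-\lambda_{\rm oo}^2\bigr)^{1/2},\qquad \sigma_{\rm eo}=\bigl(C_{\rm o}^{-1}\|M_{\rm eo}|\beta\rangle\|^2-\lambda_{\rm oe}^2\bigr)^{1/2},$$ $$\sigma_{\rm oe}=\sigma_{\rm oo}^{-1}\bigl((C_{\rm o}C_{\rm e})^{-1/2}\langle\beta|M_{\rm oo}M_{\rm oe}|\beta\rangle-\lambda_{\rm oo}\lambda_{\rm oe}\bigr),\qquad \sigma_{\rm ee}=\sigma_{\rm eo}^{-1}\bigl((C_{\rm o}C_{\rm e})^{-1/2}\langle\beta|M_{\rm oe}M_{\rm ee}|\beta\rangle-\lambda_{\rm oe}\lambda_{\rm ee}\bigr),$$ $$\Delta_{\rm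 oe}=\bigl(C_{\rm e}^{-1}\|M_{\rm oe}|\beta\rangle\|^2-\lambda_{\rm oe}^2-\sigma_{\rm oe}^2\bigr)^{1/2},\qquad \Delta_{\rm ee}=\bigl(C_{\rm e}^{-1}\|M_{\rm ee}|\beta\rangle\|^2-\lambda_{\rm ee}^2-\sigma_{\rm ee}^2\bigr)^{1/2},$$ where $\sigma_{\rm oe}:=0$ if $\sigma_{\rm oo}=0$ and $\sigma_{\rm ee}:=0$ if $\sigma_{\rm eo}=0$. For $\kappa,\gamma\in\mathbb{R}$ let $$M_{\rm 6d}^{(0)}=\begin{pmatrix}1&0&0&\Delta_{\rm oe}&0&0\\0&1&\sigma_{\rm oo}&\sigma_{\rm oe}&0&0\\0&\sigma_{\rm oo}&\kappa C_{\rm o}+\lambda_{\rm oo}&\kappa\sqrt{C_{\rm o}C_{\rm e}}+\lambda_{\rm oe}&\sigma_{\rm eo}&0\\\Delta_{\rm oe}&\sigma_{\rm oe}&\kappa\sqrt{C_{\rm o}C_{\rm e}}+\lambda_{\rm oe}&\kappa C_{\rm e}+\lambda_{\rm ee}-\gamma&\sigma_{\rm ee}&\Delta_{\rm ee}\\0&0&\sigma_{\rm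 eo}&\sigma_{\rm ee}&1-\gamma&0\\0&0&0&\Delta_{\rm ee}&0&1-\gamma\end{pmatrix},$$ $$M_{\rm 6d}^{(1)}=\begin{pmatrix}1-\gamma&0&0&\Delta_{\rm oe}&0&0\\0&1-\gamma&\sigma_{\rm oo}&-\sigma_{\rm oe}&0&0\\0&\sigma_{\rm oo}&\kappa C_{\rm o}+\lambda_{\rm oo}-\gamma&\kappa\sqrt{C_{\rm o}C_{\rm e}}-\lambda_{\rm oe}&\sigma_{\rm eo}&0\\\Delta_{\rm oe}&-\sigma_{\rm oe}&\kappa\sqrt{C_{\rm o}C_{\rm e}}-\lambda_{\rm oe}&\kappa C_{\rm e}+\lambda_{\rm ee}&-\sigma_{\rm ee}&\Delta_{\rm ee}\\0&0&\sigma_{\rm eo}&-\sigma_{\rm ee}&1&0\\0&0&0&\Delta_{\rm ee}&0&1\end{pmatrix},$$ and let $B^{\rm hom}(\kappa,\gamma)$ be the larger of the largest eigenvalues of $M_{\rm 6d}^{(0)}$ and $M_{\rm 6d}^{(1)}$. \textbf{Claim.} The integrals above define bounded operators; $M'_{\rm oe}=-M_{\rm oe}$; $C_{\rm o}=e^{-\beta^2}\sinh\beta^2$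 and $C_{\rm e}=e^{-\beta^2}\cosh\beta^2$; the matrix elements $\langle\beta|\cdot|\beta\rangle$ above are real; $B^{\rm hom}$ is a convex function of $(\kappa,\gamma)$; and for all $\kappa,\gamma\ge0$ $$M^{\rm hom}[\kappa,\gamma]\le B^{\rm hom}(\kappa,\gamma)\,I_{AC}.$$ -/

import Mathlib

open MeasureTheory
open scoped Kronecker Matrix

namespace HomodyneQKD

noncomputable section

/-! ### Operator-valued integrals in the weak sense -/

section WeakIntegral

variable {H : Type*} [NormedAddCommGroup H] [InnerProductSpace ℂ H]

/-- `M = ∫ dx Q(x)` in the weak sense, where `Q x φ ψ` is the matrix element `⟨φ|Q(x)|ψ⟩` of a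
sesquilinear form (such as `⟨φ|x⟩⟨x|ψ⟩`): every matrix element is integrable and integrates to
the corresponding matrix element of the bounded operator `M`. Such an `M` is unique. -/
def IsOpIntegral (Q : ℝ → H → H → ℂ) (M : H →L[ℂ] H) : Prop :=
  ∀ φ ψ : H, Integrable (fun x => Q x φ ψ) ∧ inner ℂ φ (M ψ) = ∫ x, Q x φ ψ

open Classical in
/-- The bounded operator `∫ dx Q(x)` (and `0` if the weak integral does not exist). -/
def opIntegral (Q : ℝ → H → H → ℂ) : H →L[ℂ] H :=
  if h : ∃ M, IsOpIntegral Q M then h.choose else 0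

end WeakIntegral

/-! ### The optical mode `C` -/

/-- The Hilbert space of the optical pulse, in the position (quadrature) representation:
the bra `⟨x|` evaluates the wave function at `x`. -/
abbrev ModeC : Type := Lp ℂ 2 (volume : Measure ℝ)

theorem memLp_polynomial_mul_gaussian (p : Polynomial ℝ) :
    MemLp (fun x : ℝ => p.eval x * Real.exp (-x ^ 2)) 2 (volume : Measure ℝ) := by
  induction p using Polynomial.induction_on' with
  | add p q hp hq =>
    have h := hp.add hq
    refine h.ae_eq (Filter.Eventually.of_forall fun x => ?_)
    simp [add_mul]
  | monomial n a =>
    have hm : AEStronglyMeasurable (fun x : ℝ => x ^ n * Real.exp (-x ^ 2)) volume :=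
      (by fun_prop : Continuous fun x : ℝ => x ^ n * Real.exp (-x ^ 2)).aestronglyMeasurable
    have h : MemLp (fun x : ℝ => x ^ n * Real.exp (-x ^ 2)) 2 (volume : Measure ℝ) := by
      rw [memLp_two_iff_integrable_sq hm]
      have h0 : (-1 : ℝ) < ((2 * n : ℕ) : ℝ) :=
        lt_of_lt_of_le (by norm_num) (Nat.cast_nonneg _)
      have hi := integrable_rpow_mul_exp_neg_mul_sq (b := 2) (by norm_num) h0
      refine hi.congr (Filter.Eventually.of_forall fun x => ?_)
      simp only [Real.rpow_natCast]
      rw [mul_pow, ← pow_mul, ← Real.exp_nat_mul, mul_comm n 2]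
      congr 2
      push_cast
      ring
    refine (h.const_mul a).ae_eq (Filter.Eventually.of_forall fun x => ?_)
    simp [mul_assoc]

/-- The wave function of the `n`-photon state, with the quadrature normalized such that the
vacuum has variance `1/4`. (`Polynomial.hermite` is the probabilists' Hermite polynomial, the
orthogonal polynomial of the standard normal law of `2x`.) -/
def numberWave (n : ℕ) (x : ℝ) : ℝ :=
  (2 / Real.pi) ^ (1 / 4 : ℝ) / Real.sqrt (n.factorial : ℝ)
    * (Polynomial.aeval (2 * x) (Polynomial.hermite n) * Real.exp (-x ^ 2))

theorem memLp_numberWave (n : ℕ) :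
    MemLp (fun x : ℝ => (numberWave n x : ℂ)) 2 (volume : Measure ℝ) := by
  refine MemLp.ofReal (MemLp.const_mul ?_ _)
  have h := memLp_polynomial_mul_gaussian
    (((Polynomial.hermite n).map (Int.castRingHom ℝ)).comp (2 * Polynomial.X))
  refine h.ae_eq (Filter.Eventually.of_forall fun x => ?_)
  simp only [Polynomial.eval_comp, Polynomial.eval_mul, Polynomial.eval_ofNat, Polynomial.eval_X]
  rw [Polynomial.aeval_def, Polynomial.eval_map]
  rfl

/-- The photon-number state `|n⟩`. -/
def numberState (n : ℕ) : ModeC := (memLp_numberWave n).toLp _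

/-- The projection onto the subspace of even photon numbers. -/
def projEven : ModeC →L[ℂ] ModeC :=
  (Submodule.span ℂ (Set.range fun k : ℕ => numberState (2 * k))).topologicalClosure.starProjection

/-- The projection onto the subspace of odd photon numbers. -/
def projOdd : ModeC →L[ℂ] ModeC :=
  (Submodule.span ℂ
    (Set.range fun k : ℕ => numberState (2 * k + 1))).topologicalClosure.starProjection

/-- The wave function `⟨x|b⟩` of the coherent state with real amplitude `b`. -/
def coherentWave (b x : ℝ) : ℝ :=
  (2 / Real.pi) ^ (1 / 4 : ℝ) * Real.exp (-(x - b) ^ 2)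

theorem memLp_coherentWave (b : ℝ) :
    MemLp (fun x : ℝ => (coherentWave b x : ℂ)) 2 (volume : Measure ℝ) := by
  refine MemLp.ofReal (MemLp.const_mul ?_ _)
  have h := (memLp_polynomial_mul_gaussian 1).comp_measurePreserving
    (measurePreserving_sub_right (volume : Measure ℝ) b)
  refine h.ae_eq (Filter.Eventually.of_forall fun x => ?_)
  simp

/-- The coherent state `|b⟩` with real amplitude `b`. -/
def coherentState (b : ℝ) : ModeC := (memLp_coherentWave b).toLp _

/-! ### Qubits -/

/-- The vectors `|0⟩`, `|1⟩`, `|+⟩`, `|-⟩` of a qubit. -/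
def ket0 : Fin 2 → ℂ := ![1, 0]
def ket1 : Fin 2 → ℂ := ![0, 1]
def ketPlus : Fin 2 → ℂ := ![1 / (Real.sqrt 2 : ℂ), 1 / (Real.sqrt 2 : ℂ)]
def ketMinus : Fin 2 → ℂ := ![1 / (Real.sqrt 2 : ℂ), -(1 / (Real.sqrt 2 : ℂ))]

/-- `P̂(v) = |v⟩⟨v|`. -/
def dyad (v : Fin 2 → ℂ) : Matrix (Fin 2) (Fin 2) ℂ := Matrix.vecMulVec v (star v)

/-- The Pauli matrix `X`. -/
def pauliX : Matrix (Fin 2) (Fin 2) ℂ := !![0, 1; 1, 0]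

/-- Operators on the two qubits `A`, `B`; the index is the pair (basis label of `A`, of `B`). -/
abbrev OpAB : Type := Matrix (Fin 2 × Fin 2) (Fin 2 × Fin 2) ℂ

/-- Controlled-NOT with control `B` and target `A`. -/
def cnotBA : OpAB := (1 : Matrix (Fin 2) (Fin 2) ℂ) ⊗ₖ dyad ket0 + pauliX ⊗ₖ dyad ket1

/-! ### The twisting operation -/

/-- `q_{μ,β} = (1 - e^{-2(μ-β²)})/2`. -/
def qParam (μ β : ℝ) : ℝ := (1 - Real.exp (-2 * (μ - β ^ 2))) / 2

/-- The vector `√g_{β,1/4}(x) |0⟩ + s √g_{-β,1/4}(x) |1⟩`, where `g_{m,V}` is the density of the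
normal law with mean `m` and variance `V`. -/
def gaussVec (β s x : ℝ) : Fin 2 → ℂ :=
  ![(Real.sqrt (ProbabilityTheory.gaussianPDFReal β (1 / 4) x) : ℂ),
    (s : ℂ) * (Real.sqrt (ProbabilityTheory.gaussianPDFReal (-β) (1 / 4) x) : ℂ)]

/-- The operator `τ_{AB}^{hom}(x)`. -/
def tauHom (μ β x : ℝ) : OpAB :=
  ((1 - qParam μ β : ℝ) : ℂ) • (dyad (gaussVec β 1 x) ⊗ₖ dyad ketPlus)
    + ((qParam μ β : ℝ) : ℂ) • (dyad (gaussVec β (-1) x) ⊗ₖ dyad ketMinus)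

/-- The operator `⟨0|_B τ_{AB}^{hom}(x) |1⟩_B` on `A`. -/
def tauHom01 (μ β x : ℝ) : Matrix (Fin 2) (Fin 2) ℂ :=
  Matrix.of fun a a' => tauHom μ β x (a, 0) (a', 1)

/-- `W_A^{hom}(x) = |u₊⟩⟨u₊| - |u₋⟩⟨u₋|`, where `u₊`, `u₋` are the unit eigenvectors of the
Hermitian matrix `⟨0|_B τ_{AB}^{hom}(x) |1⟩_B` with positive and negative eigenvalue. It is the
unitary factor of the polar decomposition of that matrix. -/
def twistW (μ β x : ℝ) : Matrix (Fin 2) (Fin 2) ℂ := cfc Real.sign (tauHom01 μ β x)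

/-- The controlled unitary `V^{hom}_{B;A→A}(x)`, with `V⁽⁰⁾ = I` and `V⁽¹⁾ = W`. -/
def twistV (μ β x : ℝ) : OpAB :=
  ((1 : Matrix (Fin 2) (Fin 2) ℂ) ⊗ₖ dyad ket0 + twistW μ β x ⊗ₖ dyad ket1) * cnotBA

/-! ### Operators on the joint system `AC` -/

/-- The Hilbert space of Alice's qubit and the optical pulse: `ψ` stands for
`|0⟩ ⊗ ψ 0 + |1⟩ ⊗ ψ 1`. -/
abbrev SpaceAC : Type := PiLp 2 (fun _ : Fin 2 => ModeC)

/-- The operator `P ⊗ T` on `AC`. -/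
def tensorAC (P : Matrix (Fin 2) (Fin 2) ℂ) (T : ModeC →L[ℂ] ModeC) : SpaceAC →L[ℂ] SpaceAC :=
  ((PiLp.continuousLinearEquiv 2 ℂ (fun _ : Fin 2 => ModeC)).symm :
      (Fin 2 → ModeC) →L[ℂ] SpaceAC) ∘L
    ContinuousLinearMap.pi fun i =>
      ∑ j, P i j • (T ∘L PiLp.proj (𝕜 := ℂ) 2 (fun _ : Fin 2 => ModeC) j)

/-- `(I_A ⊗ K_suc^{hom}(x)) ψ`, with `K_suc^{hom}(x) = √f(x) (|0⟩_B⟨x|_C + |1⟩_B⟨-x|_C)`. -/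
def krausHom (f : ℝ → ℝ) (x : ℝ) (ψ : SpaceAC) : Fin 2 × Fin 2 → ℂ := fun ab =>
  (Real.sqrt (f x) : ℂ) * (ket0 ab.2 * (ψ ab.1 : ℝ → ℂ) x + ket1 ab.2 * (ψ ab.1 : ℝ → ℂ) (-x))

/-- The matrix elements of `[I ⊗ K(x)†] V(x)† (I_A ⊗ |-⟩⟨-|_B) V(x) [I ⊗ K(x)]`. -/
def phaseErrorForm (f : ℝ → ℝ) (μ β x : ℝ) (φ ψ : SpaceAC) : ℂ :=
  star (krausHom f x φ) ⬝ᵥ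
    (((twistV μ β x)ᴴ * ((1 : Matrix (Fin 2) (Fin 2) ℂ) ⊗ₖ dyad ketMinus) * twistV μ β x)
      *ᵥ krausHom f x ψ)

/-- The phase error operator `M_ph^{hom}`. -/
def phaseErrorOp (f : ℝ → ℝ) (μ β : ℝ) : SpaceAC →L[ℂ] SpaceAC :=
  opIntegral (phaseErrorForm f μ β)

/-- `Π^{fid} = |0⟩⟨0| ⊗ |β⟩⟨β| + |1⟩⟨1| ⊗ |-β⟩⟨-β|`. -/
def projFid (β : ℝ) : SpaceAC →L[ℂ] SpaceAC :=
  tensorAC (dyad ket0) (InnerProductSpace.rankOne ℂ (coherentState β) (coherentState β))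
    + tensorAC (dyad ket1) (InnerProductSpace.rankOne ℂ (coherentState (-β)) (coherentState (-β)))

/-- `Π^{trash}_- = |-⟩⟨-| ⊗ I`. -/
def projTrash : SpaceAC →L[ℂ] SpaceAC := tensorAC (dyad ketMinus) (ContinuousLinearMap.id ℂ ModeC)

/-- `M^{hom}[κ,γ] = M_ph^{hom} + κ Π^{fid} - γ Π^{trash}_-`. -/
def opM (f : ℝ → ℝ) (μ β κ γ : ℝ) : SpaceAC →L[ℂ] SpaceAC :=
  phaseErrorOp f μ β + (κ : ℂ) • projFid β - (γ : ℂ) • projTrash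

/-! ### The parameters of the six-dimensional matrices -/

/-- The angle with `|θ| ≤ π/2` and `tan θ = e^{-2(μ-β²)} sinh(4βx)`. -/
def theta (μ β x : ℝ) : ℝ := Real.arctan (Real.exp (-2 * (μ - β ^ 2)) * Real.sinh (4 * β * x))

/-- The matrix elements of `h(x) P|x⟩⟨x|P'`, for an orthogonal projection `P`. -/
def sandwichForm (h : ℝ → ℝ) (P P' : ModeC →L[ℂ] ModeC) (x : ℝ) (φ ψ : ModeC) : ℂ :=
  (h x : ℂ) * (star ((P φ : ℝ → ℂ) x) * (P' ψ : ℝ → ℂ) x)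

/-- The matrix elements of the integrand of `M_oo`. -/
def formOO (f : ℝ → ℝ) (μ β : ℝ) : ℝ → ModeC → ModeC → ℂ :=
  sandwichForm (fun x => f x * (1 + Real.cos (theta μ β x))) projOdd projOdd

/-- The matrix elements of the integrand of `M_ee`. -/
def formEE (f : ℝ → ℝ) (μ β : ℝ) : ℝ → ModeC → ModeC → ℂ :=
  sandwichForm (fun x => f x * (1 - Real.cos (theta μ β x))) projEven projEven

/-- The matrix elements of the integrand of `M_{(+,o)(-,e)}`. -/
def formOE (f : ℝ → ℝ) (μ β : ℝ) : ℝ → ModeC → ModeC → ℂ :=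
  sandwichForm (fun x => f x * Real.sin (theta μ β x)) projOdd projEven

/-- The matrix elements of the integrand of `M_{(-,o)(+,e)}`. -/
def formOE' (f : ℝ → ℝ) (μ β : ℝ) : ℝ → ModeC → ModeC → ℂ :=
  sandwichForm (fun x => -f x * Real.sin (theta μ β x)) projOdd projEven

/-- `M_oo`. -/
def opOO (f : ℝ → ℝ) (μ β : ℝ) : ModeC →L[ℂ] ModeC := opIntegral (formOO f μ β)

/-- `M_ee`. -/
def opEE (f : ℝ → ℝ) (μ β : ℝ) : ModeC →L[ℂ] ModeC := opIntegral (formEE f μ β)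

/-- `M_{(+,o)(-,e)}`. -/
def opOE (f : ℝ → ℝ) (μ β : ℝ) : ModeC →L[ℂ] ModeC := opIntegral (formOE f μ β)

/-- `M_{(-,e)(+,o)}`. -/
def opEO (f : ℝ → ℝ) (μ β : ℝ) : ModeC →L[ℂ] ModeC := ContinuousLinearMap.adjoint (opOE f μ β)

/-- `M_{(-,o)(+,e)}`. -/
def opOE' (f : ℝ → ℝ) (μ β : ℝ) : ModeC →L[ℂ] ModeC := opIntegral (formOE' f μ β)

/-- `⟨β|T|β⟩`. -/
def braket (β : ℝ) (T : ModeC →L[ℂ] ModeC) : ℂ :=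
  inner ℂ (coherentState β) (T (coherentState β))

def coefO (β : ℝ) : ℝ := (braket β projOdd).re

def coefE (β : ℝ) : ℝ := (braket β projEven).re

def lamOO (f : ℝ → ℝ) (μ β : ℝ) : ℝ := (coefO β)⁻¹ * (braket β (opOO f μ β)).re

def lamEE (f : ℝ → ℝ) (μ β : ℝ) : ℝ := (coefE β)⁻¹ * (braket β (opEE f μ β)).re

def lamOE (f : ℝ → ℝ) (μ β : ℝ) : ℝ :=
  (Real.sqrt (coefO β * coefE β))⁻¹ * (braket β (opOE f μ β)).re

def sigOO (f : ℝ → ℝ) (μ β : ℝ) : ℝ :=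
  Real.sqrt ((coefO β)⁻¹ * ‖opOO f μ β (coherentState β)‖ ^ 2 - lamOO f μ β ^ 2)

def sigEO (f : ℝ → ℝ) (μ β : ℝ) : ℝ :=
  Real.sqrt ((coefO β)⁻¹ * ‖opEO f μ β (coherentState β)‖ ^ 2 - lamOE f μ β ^ 2)

/-- `σ_{(+,o)(-,e)}`. If `σ_oo = 0`, the bracket vanishes as well, and the value is `0`. -/
def sigOE (f : ℝ → ℝ) (μ β : ℝ) : ℝ :=
  (sigOO f μ β)⁻¹ *
    ((Real.sqrt (coefO β * coefE β))⁻¹ * (braket β (opOO f μ β ∘L opOE f μ β)).re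
      - lamOO f μ β * lamOE f μ β)

/-- `σ_{(-,e)(-,e)}`. If `σ_eo = 0`, the bracket vanishes as well, and the value is `0`. -/
def sigEE (f : ℝ → ℝ) (μ β : ℝ) : ℝ :=
  (sigEO f μ β)⁻¹ *
    ((Real.sqrt (coefO β * coefE β))⁻¹ * (braket β (opOE f μ β ∘L opEE f μ β)).re
      - lamOE f μ β * lamEE f μ β)

def delOE (f : ℝ → ℝ) (μ β : ℝ) : ℝ :=
  Real.sqrt ((coefE β)⁻¹ * ‖opOE f μ β (coherentState β)‖ ^ 2 - lamOE f μ β ^ 2 - sigOE f μ β ^ 2)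

def delEE (f : ℝ → ℝ) (μ β : ℝ) : ℝ :=
  Real.sqrt ((coefE β)⁻¹ * ‖opEE f μ β (coherentState β)‖ ^ 2 - lamEE f μ β ^ 2 - sigEE f μ β ^ 2)

/-- `M_6d⁽⁰⁾`. -/
def mat0 (f : ℝ → ℝ) (μ β κ γ : ℝ) : Matrix (Fin 6) (Fin 6) ℝ :=
  let Co := coefO β
  let Ce := coefE β
  let loo := lamOO f μ β
  let lee := lamEE f μ β
  let loe := lamOE f μ β
  let soo := sigOO f μ β
  let seo := sigEO f μ β
  let soe := sigOE f μ β
  let see := sigEE f μ β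
  let doe := delOE f μ β
  let dee := delEE f μ β
  let r := Real.sqrt (Co * Ce)
  !![1, 0, 0, doe, 0, 0;
     0, 1, soo, soe, 0, 0;
     0, soo, κ * Co + loo, κ * r + loe, seo, 0;
     doe, soe, κ * r + loe, κ * Ce + lee - γ, see, dee;
     0, 0, seo, see, 1 - γ, 0;
     0, 0, 0, dee, 0, 1 - γ]

/-- `M_6d⁽¹⁾`. -/
def mat1 (f : ℝ → ℝ) (μ β κ γ : ℝ) : Matrix (Fin 6) (Fin 6) ℝ :=
  let Co := coefO β
  let Ce := coefE β
  let loo := lamOO f μ β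
  let lee := lamEE f μ β
  let loe := lamOE f μ β
  let soo := sigOO f μ β
  let seo := sigEO f μ β
  let soe := sigOE f μ β
  let see := sigEE f μ β
  let doe := delOE f μ β
  let dee := delEE f μ β
  let r := Real.sqrt (Co * Ce)
  !![1 - γ, 0, 0, doe, 0, 0;
     0, 1 - γ, soo, -soe, 0, 0;
     0, soo, κ * Co + loo - γ, κ * r - loe, seo, 0;
     doe, -soe, κ * r - loe, κ * Ce + lee, -see, dee;
     0, 0, seo, -see, 1, 0;
     0, 0, 0, dee, 0, 1]

/-- The supremum of the spectrum of a matrix (for a symmetric one, its largest eigenvalue). -/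
def specSup (M : Matrix (Fin 6) (Fin 6) ℝ) : ℝ := sSup (spectrum ℝ M)

/-- `B^{hom}(κ,γ)`. -/
def boundB (f : ℝ → ℝ) (μ β κ γ : ℝ) : ℝ :=
  max (specSup (mat0 f μ β κ γ)) (specSup (mat1 f μ β κ γ))

end

end HomodyneQKD

open HomodyneQKD

open MeasureTheory
open scoped Kronecker Matrix

namespace HomodyneQKD

noncomputable section

/-! ### Completeness of the photon-number states -/

/-! The twist can be computed explicitly. The off-diagonal block of τ equals t + s(sin θ Z + cos θ
X) with |t| < s, so its sign is the reflection sin θ Z + cos θ X (`twistW_eq`), and this reflection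
times X is a rotation. The outcome |-⟩ on B thus measures ψ(x) - Rot(θ)ψ(-x) with weight f(x)/2.
Splitting ψ by parity on C and by |±⟩ on A, the phase error operator falls into the blocks
(+,odd)⊕(-,even) and (-,odd)⊕(+,even), with entries M_oo, ±M_oe, ±M_eo, M_ee
(`IsAcceptance.isOpIntegral_phaseErrorForm`). The projections onto even and odd photon numbers are
(1 ± R)/2 with R the reflection x ↦ -x; this rests on completeness of the Hermite functions
(`eq_zero_of_forall_inner_numberState`).

The other two terms respect the splitting: in each block the fidelity term has rank one, along the
pair of the odd and even parts of |β⟩, and the trash term is the identity on the summand labelled -.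

Each block of the phase error operator is at most the identity (`IsAcceptance.block_le`). Its
density is twice a projection and gives an even function of x, so f may be replaced by (f(x) +
f(-x))/2 ≤ 1/2. Let p and k be the normalized odd and even parts of |β⟩. They couple to their
complement only through their images under the block, and Gram-Schmidt places these images in two
further directions of each parity: six dimensions in all (`exists_gramSchmidt_frame`). On the
complement of p and k the block is replaced by its upper bound, the identity. This produces the
diagonal entries 1 and 1 - γ, which also control everything outside the six dimensions
(`two_block_form_le`).

Convexity holds because both matrices are affine in (κ, γ) and the largest eigenvalue of a symmetric
matrix is a maximum of Rayleigh quotients. -/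

theorem ae_eq_zero_of_forall_integral_cexp_mul {f : ℝ → ℝ} (hf : Integrable f)
    (h : ∀ t : ℝ, ∫ x : ℝ, Complex.exp (t * x * Complex.I) * (f x : ℂ) = 0) :
    f =ᵐ[volume] 0 := by
  have hp : AEMeasurable (fun x => ENNReal.ofReal (f x)) volume :=
    hf.aemeasurable.ennreal_ofReal
  have hn : AEMeasurable (fun x => ENNReal.ofReal (-f x)) volume :=
    hf.neg.aemeasurable.ennreal_ofReal
  have : IsFiniteMeasure (volume.withDensity fun x => ENNReal.ofReal (f x)) :=
    isFiniteMeasure_withDensity_ofReal hf.2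
  have : IsFiniteMeasure (volume.withDensity fun x => ENNReal.ofReal (-f x)) :=
    isFiniteMeasure_withDensity_ofReal hf.neg.2
  have hE : ∀ (t : ℝ) {k : ℝ → ℝ}, Integrable k →
      Integrable fun x : ℝ => (max (k x) 0) • Complex.exp (t * x * Complex.I) := by
    intro t k hk
    refine (hk.pos_part.ofReal (𝕜 := ℂ)).mono ?_ ?_
    · refine hk.pos_part.aestronglyMeasurable.smul (Continuous.aestronglyMeasurable ?_)
      fun_prop
    · refine Filter.Eventually.of_forall fun x => ?_
      have : ‖Complex.exp (t * x * Complex.I)‖ = 1 := by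
        rw [← Complex.ofReal_mul, Complex.norm_exp_ofReal_mul_I]
      rw [norm_smul, this, mul_one]
      simp
  -- The positive and negative parts of `f` are densities of finite measures. The hypothesis says
  -- that their characteristic functions agree, so the measures agree.
  have hmeas : (volume.withDensity fun x => ENNReal.ofReal (f x)) =
      volume.withDensity fun x => ENNReal.ofReal (-f x) := by
    refine Measure.ext_of_charFun (funext fun t => ?_)
    rw [charFun_apply_real, charFun_apply_real,
      integral_withDensity_eq_integral_toReal_smul₀ hp (by simp),
      integral_withDensity_eq_integral_toReal_smul₀ hn (by simp), ← sub_eq_zero]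
    simp only [ENNReal.toReal_ofReal']
    rw [← integral_sub (hE t hf) (hE t (k := fun x => -f x) hf.neg), ← h t]
    refine integral_congr_ae (Filter.Eventually.of_forall fun x => ?_)
    simp only [← sub_smul]
    rw [max_zero_sub_eq_self, Complex.real_smul, mul_comm]
  rw [withDensity_eq_iff_of_sigmaFinite hp hn] at hmeas
  filter_upwards [hmeas] with x hx
  have := congrArg ENNReal.toReal hx
  simp only [ENNReal.toReal_ofReal'] at this
  have h2 := max_zero_sub_eq_self (f x)
  rw [Pi.zero_apply, ← h2, this, sub_self]

theorem memLp_exp_mul_gaussian (t : ℝ) :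
    MemLp (fun x : ℝ => Real.exp (t * x) * Real.exp (-x ^ 2)) 2 (volume : Measure ℝ) := by
  have h := ((memLp_polynomial_mul_gaussian 1).comp_measurePreserving
    (measurePreserving_sub_right (volume : Measure ℝ) (t / 2))).const_mul (Real.exp (t ^ 2 / 4))
  refine h.ae_eq (Filter.Eventually.of_forall fun x => ?_)
  simp only [Function.comp, Polynomial.eval_one, one_mul, ← Real.exp_add]
  congr 1
  ring

theorem memLp_exp_abs_mul_gaussian (t : ℝ) :
    MemLp (fun x : ℝ => Real.exp |t * x| * Real.exp (-x ^ 2)) 2 (volume : Measure ℝ) := by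
  refine ((memLp_exp_mul_gaussian t).add (memLp_exp_mul_gaussian (-t))).mono
    (by fun_prop : Continuous fun x : ℝ => Real.exp |t * x| * Real.exp (-x ^ 2)).aestronglyMeasurable
    (Filter.Eventually.of_forall fun x => ?_)
  simp only [Pi.add_apply, ← add_mul]
  rw [Real.norm_of_nonneg (by positivity), Real.norm_of_nonneg (by positivity)]
  refine mul_le_mul_of_nonneg_right ?_ (Real.exp_pos _).le
  rcases abs_cases (t * x) with ⟨h, -⟩ | ⟨h, -⟩ <;> rw [h]
  · exact le_add_of_nonneg_right (Real.exp_pos _).le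
  · rw [neg_mul]
    exact le_add_of_nonneg_left (Real.exp_pos _).le

/-- Expanding the Fourier kernel as a power series under the integral shows that the Fourier
transform of exp(-x²)g vanishes. The exchange is dominated by exp(|tx|)exp(-x²)|g|, integrable as a
product of two square-integrable functions. -/
theorem ae_eq_zero_of_forall_gaussian_moment {g : ℝ → ℝ} (hg : MemLp g 2 (volume : Measure ℝ))
    (h : ∀ n : ℕ, ∫ x : ℝ, x ^ n * (Real.exp (-x ^ 2) * g x) = 0) : g =ᵐ[volume] 0 := by
  have hmul : ∀ {k : ℝ → ℝ}, MemLp k 2 (volume : Measure ℝ) → Integrable (fun x => k x * g x) :=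
    fun hk => hk.integrable_mul hg
  have hF : Integrable fun x => Real.exp (-x ^ 2) * g x := by
    have := hmul (memLp_exp_mul_gaussian 0)
    simpa using this
  have hzero : ∀ t : ℝ, ∫ x : ℝ, Complex.exp (t * x * Complex.I) *
      ((Real.exp (-x ^ 2) * g x : ℝ) : ℂ) = 0 := by
    intro t
    have hs := hasSum_integral_of_dominated_convergence (μ := (volume : Measure ℝ))
      (F := fun (n : ℕ) (x : ℝ) => ((t * x * Complex.I) ^ n / (n.factorial : ℂ)) *
        ((Real.exp (-x ^ 2) * g x : ℝ) : ℂ))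
      (f := fun x : ℝ => Complex.exp (t * x * Complex.I) *
        ((Real.exp (-x ^ 2) * g x : ℝ) : ℂ))
      (fun n x => |t * x| ^ n / (n.factorial : ℝ) * |Real.exp (-x ^ 2) * g x|)
      ?_ ?_ ?_ ?_ ?_
    · refine hs.unique ?_
      have hn : ∀ n : ℕ, ∫ x : ℝ, ((t * x * Complex.I) ^ n / (n.factorial : ℂ)) *
          ((Real.exp (-x ^ 2) * g x : ℝ) : ℂ) = 0 := by
        intro n
        have : ∀ x : ℝ, ((t * x * Complex.I) ^ n / (n.factorial : ℂ)) *
            ((Real.exp (-x ^ 2) * g x : ℝ) : ℂ) =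
            ((t * Complex.I) ^ n / (n.factorial : ℂ)) *
              ((x ^ n * (Real.exp (-x ^ 2) * g x) : ℝ) : ℂ) := by
          intro x
          push_cast
          ring
        simp only [this]
        rw [integral_const_mul, integral_complex_ofReal, h n]
        simp
      simp only [hn]
      exact hasSum_zero
    · intro n
      refine AEStronglyMeasurable.mul (Continuous.aestronglyMeasurable (by fun_prop)) ?_
      exact (hF.ofReal (𝕜 := ℂ)).aestronglyMeasurable
    · refine fun n => Filter.Eventually.of_forall fun x => le_of_eq ?_
      simp only [norm_mul, norm_div, norm_pow, Complex.norm_I, mul_one, Complex.norm_real,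
        Complex.norm_natCast, Real.norm_eq_abs, abs_mul]
    · refine Filter.Eventually.of_forall fun x => Summable.mul_right _ ?_
      exact Real.summable_pow_div_factorial _
    · have hb := (hmul (memLp_exp_abs_mul_gaussian t)).abs
      refine hb.congr (Filter.Eventually.of_forall fun x => ?_)
      simp only
      rw [tsum_mul_right, mul_assoc, abs_mul, abs_of_pos (Real.exp_pos _), Real.exp_eq_exp_ℝ,
        NormedSpace.exp_eq_tsum_div]
    · refine Filter.Eventually.of_forall fun x => HasSum.mul_right _ ?_
      rw [Complex.exp_eq_exp_ℂ]
      exact NormedSpace.expSeries_div_hasSum_exp _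
  filter_upwards [ae_eq_zero_of_forall_integral_cexp_mul hF hzero] with x hx
  simpa [(Real.exp_pos _).ne'] using hx

/-- The Hermite polynomials, as a polynomial sequence with real coefficients. -/
def hermiteSequence : Polynomial.Sequence ℝ where
  elems' n := (Polynomial.hermite n).map (Int.castRingHom ℝ)
  degree_eq' n := by
    rw [(Polynomial.hermite_monic n).degree_map, Polynomial.degree_hermite]

theorem span_hermite_eq_top :
    Submodule.span ℝ (Set.range fun n => (Polynomial.hermite n).map (Int.castRingHom ℝ)) = ⊤ :=
  hermiteSequence.span fun n => by
    have : (hermiteSequence n).leadingCoeff = 1 :=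
      (Polynomial.hermite_monic n).map (Int.castRingHom ℝ)
    rw [this]
    exact isUnit_one

theorem integrable_polynomial_mul_gaussian_mul (g : ModeC) (p : Polynomial ℝ) :
    Integrable fun x : ℝ => ((p.eval x * Real.exp (-x ^ 2) : ℝ) : ℂ) * g x :=
  ((memLp_polynomial_mul_gaussian p).ofReal (K := ℂ)).integrable_mul (Lp.memLp g)

theorem inner_numberState (n : ℕ) (g : ModeC) :
    inner ℂ (numberState n) g = ∫ x : ℝ, (numberWave n x : ℂ) * g x := by
  rw [L2.inner_def]
  refine integral_congr_ae ?_
  filter_upwards [(memLp_numberWave n).coeFn_toLp] with x hx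
  simp only [numberState, hx, RCLike.inner_apply, Complex.conj_ofReal]
  ring

/-- Hermite polynomials span all real polynomials, so orthogonality to every number state kills all
Gaussian moments, separately for the real and imaginary parts of `g`. -/
theorem eq_zero_of_forall_inner_numberState {g : ModeC}
    (h : ∀ n, inner ℂ (numberState n) g = 0) : g = 0 := by
  have hpoly : ∀ p : Polynomial ℝ,
      ∫ x : ℝ, (((p.comp (2 * Polynomial.X)).eval x * Real.exp (-x ^ 2) : ℝ) : ℂ) * g x = 0 := by
    intro p
    have hp : p ∈ Submodule.span ℝ
        (Set.range fun n => (Polynomial.hermite n).map (Int.castRingHom ℝ)) :=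
      span_hermite_eq_top ▸ Submodule.mem_top
    induction hp using Submodule.span_induction with
    | mem p hp =>
      obtain ⟨n, rfl⟩ := hp
      have hn := h n
      have hc : (((2 / Real.pi) ^ (1 / 4 : ℝ) / Real.sqrt (n.factorial : ℝ) : ℝ) : ℂ) ≠ 0 := by
        have : 0 < (2 / Real.pi) ^ (1 / 4 : ℝ) / Real.sqrt (n.factorial : ℝ) := by positivity
        exact_mod_cast this.ne'
      rw [inner_numberState] at hn
      refine (mul_eq_zero.mp ?_).resolve_left hc
      rw [← hn, ← integral_const_mul]
      refine integral_congr_ae (Filter.Eventually.of_forall fun x => ?_)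
      have : Polynomial.aeval (2 * x) (Polynomial.hermite n) =
          (((Polynomial.hermite n).map (Int.castRingHom ℝ)).comp (2 * Polynomial.X)).eval x := by
        simp only [Polynomial.eval_comp, Polynomial.eval_mul, Polynomial.eval_ofNat,
          Polynomial.eval_X]
        rw [Polynomial.aeval_def, Polynomial.eval_map]
        rfl
      simp only [numberWave, this]
      push_cast
      ring
    | zero => simp
    | add p q _ _ hp hq =>
      rw [← add_zero (0 : ℂ)]
      nth_rewrite 1 [← hp]
      rw [← hq, ← integral_add (integrable_polynomial_mul_gaussian_mul g _)
        (integrable_polynomial_mul_gaussian_mul g _)]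
      refine integral_congr_ae (Filter.Eventually.of_forall fun x => ?_)
      simp only [Polynomial.add_comp, Polynomial.eval_add]
      push_cast
      ring
    | smul a p _ hp =>
      rw [← mul_zero (a : ℂ), ← hp, ← integral_const_mul]
      refine integral_congr_ae (Filter.Eventually.of_forall fun x => ?_)
      simp only [Polynomial.smul_comp, Polynomial.eval_smul, smul_eq_mul]
      push_cast
      ring
  have hmom : ∀ n : ℕ, ∫ x : ℝ, ((x ^ n * Real.exp (-x ^ 2) : ℝ) : ℂ) * g x = 0 := by
    intro n
    have h2 : ((2 : ℂ) ^ n) ≠ 0 := pow_ne_zero _ two_ne_zero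
    refine (mul_eq_zero.mp ?_).resolve_left h2
    rw [← hpoly (Polynomial.X ^ n), ← integral_const_mul]
    refine integral_congr_ae (Filter.Eventually.of_forall fun x => ?_)
    simp [mul_pow, mul_assoc]
  have hint : ∀ n : ℕ, Integrable fun x : ℝ => ((x ^ n * Real.exp (-x ^ 2) : ℝ) : ℂ) * g x := by
    intro n
    simpa using integrable_polynomial_mul_gaussian_mul g (Polynomial.X ^ n)
  have hre := ae_eq_zero_of_forall_gaussian_moment (Lp.memLp g).re fun n => by
    have := congrArg Complex.re (hmom n)
    rw [← RCLike.re_eq_complex_re, ← integral_re (hint n)] at this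
    simpa [mul_assoc, ← Complex.ofReal_pow, Complex.re_ofReal_mul,
      ← Complex.ofReal_neg, ← Complex.ofReal_exp] using this
  have him := ae_eq_zero_of_forall_gaussian_moment (Lp.memLp g).im fun n => by
    have := congrArg Complex.im (hmom n)
    rw [← RCLike.im_eq_complex_im, ← integral_im (hint n)] at this
    simpa [mul_assoc, ← Complex.ofReal_pow, Complex.im_ofReal_mul,
      ← Complex.ofReal_neg, ← Complex.ofReal_exp] using this
  refine (Lp.eq_zero_iff_ae_eq_zero).2 ?_
  filter_upwards [hre, him] with x h1 h2
  exact Complex.ext h1 h2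

/-! ### Parity -/

/-- The projection onto the closed span of vectors fixed by a self-adjoint involution `R` is
`(1 + R) / 2`, if these vectors are total together with vectors on which `R` is `-1`. -/
theorem starProjection_closure_span_eq_of_involution {H : Type*} [NormedAddCommGroup H]
    [InnerProductSpace ℂ H] [CompleteSpace H] (R : H →L[ℂ] H)
    (hsymm : ∀ x y, inner ℂ (R x) y = inner ℂ x (R y)) (hinv : ∀ x, R (R x) = x) (S T : Set H)
    (hS : ∀ s ∈ S, R s = s) (hT : ∀ t ∈ T, R t = -t)
    (htotal : ∀ g, (∀ s ∈ S, inner ℂ s g = 0) → (∀ t ∈ T, inner ℂ t g = 0) → g = 0) (x : H) :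
    (Submodule.span ℂ S).topologicalClosure.starProjection x = (1 / 2 : ℂ) • (x + R x) := by
  set K := (Submodule.span ℂ S).topologicalClosure with hK
  have hSK : ∀ s ∈ S, s ∈ K := fun s hs =>
    Submodule.le_topologicalClosure _ (Submodule.subset_span hs)
  have hRK : ∀ y ∈ K, R y = y := by
    have hle : K ≤ LinearMap.ker ((R - ContinuousLinearMap.id ℂ H : H →L[ℂ] H) : H →ₗ[ℂ] H) := by
      refine Submodule.topologicalClosure_minimal _ (Submodule.span_le.2 fun s hs => ?_)
        (R - ContinuousLinearMap.id ℂ H).isClosed_ker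
      simp [hS s hs]
    intro y hy
    have := hle hy
    simpa [sub_eq_zero] using this
  refine Submodule.eq_starProjection_of_mem_of_inner_eq_zero ?_ ?_
  · set v := (1 / 2 : ℂ) • (x + R x) with hv
    have hRv : R v = v := by
      rw [hv, map_smul, map_add, hinv, add_comm]
    -- This vector is orthogonal to `S` as the residual of a projection, and to `T` because `R`
    -- fixes it and negates `T`. Totality then puts `v` in `K`.
    have h0 : v - K.starProjection v = 0 := by
      refine htotal _ (fun s hs => ?_) (fun t ht => ?_)
      · rw [← inner_conj_symm, K.starProjection_inner_eq_zero v s (hSK s hs), map_zero]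
      · have hR : R (v - K.starProjection v) = v - K.starProjection v := by
          rw [map_sub, hRv, hRK _ (K.starProjection_apply_mem v)]
        have h1 := hsymm t (v - K.starProjection v)
        rw [hR, hT t ht, inner_neg_left] at h1
        exact self_eq_neg.mp h1.symm
    rw [sub_eq_zero.mp h0]
    exact K.starProjection_apply_mem v
  · intro w hw
    have h1 : inner ℂ (R x) w = inner ℂ x w := by rw [hsymm, hRK w hw]
    rw [inner_sub_left, inner_smul_left, inner_add_left, h1]
    simp only [map_div₀, map_one, map_ofNat]
    ring

/-- The parity operator `ψ(x) ↦ ψ(-x)`. -/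
def parity : ModeC →L[ℂ] ModeC :=
  (Lp.compMeasurePreservingₗᵢ ℂ (fun x : ℝ => -x)
    (Measure.measurePreserving_neg (volume : Measure ℝ))).toContinuousLinearMap

theorem coeFn_parity (ψ : ModeC) : parity ψ =ᵐ[volume] fun x => ψ (-x) :=
  Lp.coeFn_compMeasurePreserving ψ (Measure.measurePreserving_neg (volume : Measure ℝ))

theorem ae_neg {p : ℝ → Prop} (h : ∀ᵐ x : ℝ, p x) : ∀ᵐ x : ℝ, p (-x) :=
  (Measure.measurePreserving_neg (volume : Measure ℝ)).quasiMeasurePreserving.ae h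

theorem parity_parity (ψ : ModeC) : parity (parity ψ) = ψ := by
  refine Lp.ext ?_
  filter_upwards [coeFn_parity (parity ψ), ae_neg (coeFn_parity ψ)] with x h1 h2
  rw [h1, h2, neg_neg]

theorem inner_parity_left (φ ψ : ModeC) : inner ℂ (parity φ) ψ = inner ℂ φ (parity ψ) := by
  rw [L2.inner_def, L2.inner_def, ← integral_neg_eq_self]
  refine integral_congr_ae ?_
  filter_upwards [ae_neg (coeFn_parity φ), coeFn_parity ψ] with x h1 h2
  rw [h1, h2, neg_neg]

theorem hermite_aeval_neg (n : ℕ) (y : ℝ) : Polynomial.aeval (-y) (Polynomial.hermite n) =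
    (-1) ^ n * Polynomial.aeval y (Polynomial.hermite n) := by
  rw [Polynomial.aeval_eq_sum_range, Polynomial.aeval_eq_sum_range, Finset.mul_sum]
  refine Finset.sum_congr rfl fun k _ => ?_
  rcases Nat.even_or_odd (n + k) with h | h
  · have : (-1 : ℝ) ^ k = (-1) ^ n := by
      rw [← mul_left_inj' (pow_ne_zero k (by norm_num : (-1 : ℝ) ≠ 0)), ← pow_add, ← pow_add,
        h.neg_one_pow, ← two_mul, pow_mul]
      norm_num
    rw [neg_pow, this]
    simp only [zsmul_eq_mul]
    ring
  · simp [Polynomial.coeff_hermite_of_odd_add h]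

theorem parity_numberState (n : ℕ) : parity (numberState n) = (-1 : ℂ) ^ n • numberState n := by
  refine Lp.ext ?_
  filter_upwards [coeFn_parity (numberState n), (memLp_numberWave n).coeFn_toLp,
    ae_neg (memLp_numberWave n).coeFn_toLp, Lp.coeFn_smul ((-1 : ℂ) ^ n) (numberState n)]
    with x h1 h2 h3 h4
  rw [h1, h4, Pi.smul_apply, numberState, h2, h3, numberWave, numberWave, mul_neg,
    hermite_aeval_neg, neg_sq]
  push_cast
  rw [smul_eq_mul]
  ring

theorem parity_numberState_even (k : ℕ) :
    parity (numberState (2 * k)) = numberState (2 * k) := by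
  simp [parity_numberState]

theorem parity_numberState_odd (k : ℕ) :
    parity (numberState (2 * k + 1)) = -numberState (2 * k + 1) := by
  simp [parity_numberState, pow_succ]

theorem eq_zero_of_inner_even_odd {g : ModeC}
    (he : ∀ s ∈ Set.range fun k : ℕ => numberState (2 * k), inner ℂ s g = 0)
    (ho : ∀ s ∈ Set.range fun k : ℕ => numberState (2 * k + 1), inner ℂ s g = 0) : g = 0 := by
  refine eq_zero_of_forall_inner_numberState fun n => ?_
  rcases Nat.even_or_odd' n with ⟨k, rfl | rfl⟩
  · exact he _ ⟨k, rfl⟩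
  · exact ho _ ⟨k, rfl⟩

theorem projEven_apply (ψ : ModeC) : projEven ψ = (1 / 2 : ℂ) • (ψ + parity ψ) := by
  refine starProjection_closure_span_eq_of_involution parity inner_parity_left parity_parity _
    (Set.range fun k : ℕ => numberState (2 * k + 1)) ?_ ?_
    (fun g => eq_zero_of_inner_even_odd) ψ
  · rintro _ ⟨k, rfl⟩
    exact parity_numberState_even k
  · rintro _ ⟨k, rfl⟩
    exact parity_numberState_odd k

theorem projOdd_apply (ψ : ModeC) : projOdd ψ = (1 / 2 : ℂ) • (ψ - parity ψ) := by
  rw [sub_eq_add_neg]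
  -- Under `-parity` the odd number states are the fixed vectors and the even ones are negated.
  refine starProjection_closure_span_eq_of_involution (-parity)
    (by simp [inner_parity_left]) (by simp [parity_parity]) _
    (Set.range fun k : ℕ => numberState (2 * k)) ?_ ?_
    (fun g h1 h2 => eq_zero_of_inner_even_odd h2 h1) ψ
  · rintro _ ⟨k, rfl⟩
    simp [parity_numberState_odd k]
  · rintro _ ⟨k, rfl⟩
    simp [parity_numberState_even k]

theorem coeFn_projEven (ψ : ModeC) :
    projEven ψ =ᵐ[volume] fun x => (1 / 2 : ℂ) * (ψ x + ψ (-x)) := by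
  rw [projEven_apply]
  filter_upwards [Lp.coeFn_smul (1 / 2 : ℂ) (ψ + parity ψ), Lp.coeFn_add ψ (parity ψ),
    coeFn_parity ψ] with x h1 h2 h3
  rw [h1, Pi.smul_apply, h2, Pi.add_apply, h3, smul_eq_mul]

theorem coeFn_projOdd (ψ : ModeC) :
    projOdd ψ =ᵐ[volume] fun x => (1 / 2 : ℂ) * (ψ x - ψ (-x)) := by
  rw [projOdd_apply]
  filter_upwards [Lp.coeFn_smul (1 / 2 : ℂ) (ψ - parity ψ), Lp.coeFn_sub ψ (parity ψ),
    coeFn_parity ψ] with x h1 h2 h3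
  rw [h1, Pi.smul_apply, h2, Pi.sub_apply, h3, smul_eq_mul]

theorem projOdd_add_projEven (ψ : ModeC) : projOdd ψ + projEven ψ = ψ := by
  rw [projOdd_apply, projEven_apply, ← smul_add]
  module

theorem projOdd_projOdd (ψ : ModeC) : projOdd (projOdd ψ) = projOdd ψ := by
  simp only [projOdd_apply, map_smul, map_sub, parity_parity]
  module

theorem projEven_projEven (ψ : ModeC) : projEven (projEven ψ) = projEven ψ := by
  simp only [projEven_apply, map_smul, map_add, parity_parity]
  module

theorem projOdd_projEven (ψ : ModeC) : projOdd (projEven ψ) = 0 := by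
  simp only [projOdd_apply, projEven_apply, map_smul, map_add, parity_parity]
  module

theorem inner_projOdd_left (φ ψ : ModeC) : inner ℂ (projOdd φ) ψ = inner ℂ φ (projOdd ψ) :=
  Submodule.inner_starProjection_left_eq_right _ φ ψ

theorem inner_projEven_left (φ ψ : ModeC) : inner ℂ (projEven φ) ψ = inner ℂ φ (projEven ψ) :=
  Submodule.inner_starProjection_left_eq_right _ φ ψ

theorem inner_projOdd_projEven (φ ψ : ModeC) : inner ℂ (projOdd φ) (projEven ψ) = 0 := by
  rw [inner_projOdd_left, projOdd_projEven, inner_zero_right]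

theorem norm_sq_projOdd_add_norm_sq_projEven (ψ : ModeC) :
    ‖projOdd ψ‖ ^ 2 + ‖projEven ψ‖ ^ 2 = ‖ψ‖ ^ 2 := by
  have h := norm_add_sq_eq_norm_sq_add_norm_sq_of_inner_eq_zero (𝕜 := ℂ) _ _
    (inner_projOdd_projEven ψ ψ)
  rw [projOdd_add_projEven] at h
  nlinarith [h]

/-! ### Coherent states -/

theorem parity_coherentState (b : ℝ) : parity (coherentState b) = coherentState (-b) := by
  refine Lp.ext ?_
  filter_upwards [coeFn_parity (coherentState b), (memLp_coherentWave (-b)).coeFn_toLp,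
    ae_neg (memLp_coherentWave b).coeFn_toLp] with x h1 h2 h3
  rw [h1, coherentState, coherentState, h2, h3, coherentWave, coherentWave]
  congr 4
  ring

theorem inner_coherentState (a b : ℝ) :
    inner ℂ (coherentState a) (coherentState b) = (Real.exp (-(a - b) ^ 2 / 2) : ℂ) := by
  have hpi : 0 < 2 / Real.pi := by positivity
  have h1 : ((2 / Real.pi) ^ (1 / 4 : ℝ)) * ((2 / Real.pi) ^ (1 / 4 : ℝ)) =
      Real.sqrt (2 / Real.pi) := by
    rw [← Real.rpow_add hpi, Real.sqrt_eq_rpow]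
    norm_num
  have h2 : ∀ x : ℝ, coherentWave a x * coherentWave b x = Real.sqrt (2 / Real.pi) *
      Real.exp (-(a - b) ^ 2 / 2) * Real.exp (-2 * (x - (a + b) / 2) ^ 2) := by
    intro x
    rw [coherentWave, coherentWave, mul_mul_mul_comm, h1, mul_assoc, ← Real.exp_add,
      ← Real.exp_add]
    congr 2
    ring
  have h3 : ∫ x : ℝ, coherentWave a x * coherentWave b x = Real.exp (-(a - b) ^ 2 / 2) := by
    simp only [h2]
    rw [integral_const_mul, integral_sub_right_eq_self (fun x => Real.exp (-2 * x ^ 2)),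
      integral_gaussian, mul_right_comm, ← Real.sqrt_mul hpi.le]
    rw [show 2 / Real.pi * (Real.pi / 2) = 1 by field_simp, Real.sqrt_one, one_mul]
  rw [L2.inner_def, ← h3, ← integral_complex_ofReal]
  refine integral_congr_ae ?_
  filter_upwards [(memLp_coherentWave a).coeFn_toLp, (memLp_coherentWave b).coeFn_toLp]
    with x ha hb
  rw [coherentState, coherentState, ha, hb, RCLike.inner_apply, Complex.conj_ofReal]
  push_cast
  ring

theorem braket_projOdd (β : ℝ) :
    braket β projOdd = ((Real.exp (-β ^ 2) * Real.sinh (β ^ 2) : ℝ) : ℂ) := by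
  rw [braket, projOdd_apply, parity_coherentState, inner_smul_right, inner_sub_right,
    inner_coherentState, inner_coherentState, ← Complex.ofReal_sub,
    show (1 / 2 : ℂ) = ((1 / 2 : ℝ) : ℂ) by norm_num, ← Complex.ofReal_mul, Real.sinh_eq]
  congr 1
  rw [show -(β - β) ^ 2 / 2 = -β ^ 2 + β ^ 2 by ring,
    show -(β - -β) ^ 2 / 2 = -β ^ 2 + -β ^ 2 by ring, Real.exp_add, Real.exp_add]
  ring

theorem braket_projEven (β : ℝ) :
    braket β projEven = ((Real.exp (-β ^ 2) * Real.cosh (β ^ 2) : ℝ) : ℂ) := by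
  rw [braket, projEven_apply, parity_coherentState, inner_smul_right, inner_add_right,
    inner_coherentState, inner_coherentState, ← Complex.ofReal_add,
    show (1 / 2 : ℂ) = ((1 / 2 : ℝ) : ℂ) by norm_num, ← Complex.ofReal_mul, Real.cosh_eq]
  congr 1
  rw [show -(β - β) ^ 2 / 2 = -β ^ 2 + β ^ 2 by ring,
    show -(β - -β) ^ 2 / 2 = -β ^ 2 + -β ^ 2 by ring, Real.exp_add, Real.exp_add]
  ring

theorem coefO_pos {β : ℝ} (hβ : 0 < β) : 0 < coefO β := by
  rw [coefO, braket_projOdd, Complex.ofReal_re]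
  exact mul_pos (Real.exp_pos _) (Real.sinh_pos_iff.2 (by positivity))

theorem coefE_pos (β : ℝ) : 0 < coefE β := by
  rw [coefE, braket_projEven, Complex.ofReal_re]
  exact mul_pos (Real.exp_pos _) (Real.cosh_pos _)

theorem norm_sq_projOdd_coherentState (β : ℝ) : ‖projOdd (coherentState β)‖ ^ 2 = coefO β := by
  rw [coefO, braket, ← projOdd_projOdd (coherentState β), ← inner_projOdd_left, ← inner_self_eq_norm_sq (𝕜 := ℂ), projOdd_projOdd]
  rfl

theorem norm_sq_projEven_coherentState (β : ℝ) : ‖projEven (coherentState β)‖ ^ 2 = coefE β := by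
  rw [coefE, braket, ← projEven_projEven (coherentState β), ← inner_projEven_left,
    ← inner_self_eq_norm_sq (𝕜 := ℂ), projEven_projEven]
  rfl

/-! ### Weak integrals -/

section WeakIntegral

variable {H : Type*} [NormedAddCommGroup H] [InnerProductSpace ℂ H]
  {Q Q' : ℝ → H → H → ℂ} {M M' : H →L[ℂ] H}

theorem IsOpIntegral.unique (h : IsOpIntegral Q M) (h' : IsOpIntegral Q M') : M = M' :=
  ContinuousLinearMap.ext fun ψ => ext_inner_left ℂ fun φ => by
    rw [(h φ ψ).2, (h' φ ψ).2]

theorem IsOpIntegral.opIntegral_eq (h : IsOpIntegral Q M) : opIntegral Q = M := by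
  have hex : ∃ M, IsOpIntegral Q M := ⟨M, h⟩
  rw [opIntegral, dif_pos hex]
  exact hex.choose_spec.unique h

theorem IsOpIntegral.isOpIntegral_opIntegral (h : IsOpIntegral Q M) :
    IsOpIntegral Q (opIntegral Q) := h.opIntegral_eq ▸ h

theorem IsOpIntegral.add (h : IsOpIntegral Q M) (h' : IsOpIntegral Q' M') :
    IsOpIntegral (fun x φ ψ => Q x φ ψ + Q' x φ ψ) (M + M') := fun φ ψ =>
  ⟨(h φ ψ).1.add (h' φ ψ).1, by
    rw [add_apply, inner_add_right, (h φ ψ).2, (h' φ ψ).2,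
      integral_add (h φ ψ).1 (h' φ ψ).1]⟩

theorem IsOpIntegral.const_mul (c : ℂ) (h : IsOpIntegral Q M) :
    IsOpIntegral (fun x φ ψ => c * Q x φ ψ) (c • M) := fun φ ψ =>
  ⟨(h φ ψ).1.const_mul c, by
    rw [smul_apply, inner_smul_right, (h φ ψ).2, integral_const_mul]⟩

theorem IsOpIntegral.congr_ae (h : IsOpIntegral Q M)
    (hQ : ∀ φ ψ, ∀ᵐ x, Q x φ ψ = Q' x φ ψ) : IsOpIntegral Q' M := fun φ ψ =>
  ⟨(h φ ψ).1.congr (hQ φ ψ), by rw [(h φ ψ).2, integral_congr_ae (hQ φ ψ)]⟩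

end WeakIntegral

/-! ### Multiplication operators -/

/-- The bounded measurable real functions. -/
def IsBddMeas (h : ℝ → ℝ) : Prop := Measurable h ∧ ∃ C, ∀ x, |h x| ≤ C

theorem IsBddMeas.memLp {h : ℝ → ℝ} (hh : IsBddMeas h) :
    MemLp (fun x => (h x : ℂ)) ⊤ (volume : Measure ℝ) := by
  obtain ⟨hm, C, hC⟩ := hh
  refine memLp_top_of_bound (by fun_prop : Measurable fun x => (h x : ℂ)).aestronglyMeasurable C
    (Filter.Eventually.of_forall fun x => ?_)
  rw [Complex.norm_real]
  exact hC x

/-- Multiplication of wave functions by a bounded measurable real function. -/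
def mulOp {h : ℝ → ℝ} (hh : IsBddMeas h) : ModeC →L[ℂ] ModeC :=
  (ContinuousLinearMap.mul ℂ ℂ).holderL volume ⊤ 2 2 (hh.memLp.toLp _)

theorem coeFn_mulOp {h : ℝ → ℝ} (hh : IsBddMeas h) (ψ : ModeC) :
    mulOp hh ψ =ᵐ[volume] fun x => (h x : ℂ) * ψ x := by
  have h1 := (ContinuousLinearMap.mul ℂ ℂ).coeFn_holder (r := 2) (hh.memLp.toLp _) ψ
  filter_upwards [h1, hh.memLp.coeFn_toLp] with x h2 h3
  rw [h3] at h2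
  exact h2

/-- This is the source of existence for all weak integrals here: the integrand is the density of an
L² inner product with a multiplication operator in the middle. -/
theorem isOpIntegral_adjoint_mulOp {K : Type*} [NormedAddCommGroup K] [InnerProductSpace ℂ K]
    [CompleteSpace K] {h : ℝ → ℝ} (hh : IsBddMeas h) (S T : K →L[ℂ] ModeC) :
    IsOpIntegral (fun x φ ψ => (h x : ℂ) * (star ((S φ : ℝ → ℂ) x) * (T ψ : ℝ → ℂ) x))
      (ContinuousLinearMap.adjoint S ∘L mulOp hh ∘L T) := by
  intro φ ψ
  have hae : (fun x => inner ℂ ((S φ : ℝ → ℂ) x) ((mulOp hh (T ψ) : ℝ → ℂ) x)) =ᵐ[volume]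
      fun x => (h x : ℂ) * (star ((S φ : ℝ → ℂ) x) * (T ψ : ℝ → ℂ) x) := by
    filter_upwards [coeFn_mulOp hh (T ψ)] with x hx
    rw [hx, RCLike.inner_apply]
    simp only [RCLike.star_def]
    ring
  refine ⟨(L2.integrable_inner (𝕜 := ℂ) (S φ) (mulOp hh (T ψ))).congr hae, ?_⟩
  rw [← integral_congr_ae hae, ← L2.inner_def]
  simp [ContinuousLinearMap.adjoint_inner_right]

theorem inner_mulOp_left {h : ℝ → ℝ} (hh : IsBddMeas h) (φ ψ : ModeC) :
    inner ℂ (mulOp hh φ) ψ = inner ℂ φ (mulOp hh ψ) := by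
  rw [L2.inner_def, L2.inner_def]
  refine integral_congr_ae ?_
  filter_upwards [coeFn_mulOp hh φ, coeFn_mulOp hh ψ] with x h1 h2
  rw [h1, h2]
  simp only [RCLike.inner_apply, map_mul, Complex.conj_ofReal]
  ring

theorem adjoint_projOdd : ContinuousLinearMap.adjoint projOdd = projOdd :=
  ((ContinuousLinearMap.eq_adjoint_iff _ _).2 inner_projOdd_left).symm

theorem adjoint_projEven : ContinuousLinearMap.adjoint projEven = projEven :=
  ((ContinuousLinearMap.eq_adjoint_iff _ _).2 inner_projEven_left).symm

theorem adjoint_mulOp {h : ℝ → ℝ} (hh : IsBddMeas h) :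
    ContinuousLinearMap.adjoint (mulOp hh) = mulOp hh :=
  ((ContinuousLinearMap.eq_adjoint_iff _ _).2 (inner_mulOp_left hh)).symm

/-! ### Real wave functions -/

/-- The vectors with a real wave function. -/
def IsRealWave (ψ : ModeC) : Prop := ∀ᵐ x, ((ψ : ℝ → ℂ) x).im = 0

theorem isRealWave_coherentState (b : ℝ) : IsRealWave (coherentState b) := by
  filter_upwards [(memLp_coherentWave b).coeFn_toLp] with x hx
  rw [coherentState, hx, Complex.ofReal_im]

theorem IsRealWave.mulOp {h : ℝ → ℝ} (hh : IsBddMeas h) {ψ : ModeC} (hψ : IsRealWave ψ) :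
    IsRealWave (mulOp hh ψ) := by
  filter_upwards [coeFn_mulOp hh ψ, hψ] with x h1 h2
  rw [h1, Complex.im_ofReal_mul, h2, mul_zero]

theorem IsRealWave.projOdd {ψ : ModeC} (hψ : IsRealWave ψ) : IsRealWave (projOdd ψ) := by
  filter_upwards [coeFn_projOdd ψ, hψ, ae_neg hψ] with x h1 h2 h3
  rw [h1, show (1 / 2 : ℂ) = ((1 / 2 : ℝ) : ℂ) by norm_num, Complex.im_ofReal_mul,
    Complex.sub_im, h2, h3]
  simp

theorem IsRealWave.projEven {ψ : ModeC} (hψ : IsRealWave ψ) : IsRealWave (projEven ψ) := by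
  filter_upwards [coeFn_projEven ψ, hψ, ae_neg hψ] with x h1 h2 h3
  rw [h1, show (1 / 2 : ℂ) = ((1 / 2 : ℝ) : ℂ) by norm_num, Complex.im_ofReal_mul,
    Complex.add_im, h2, h3]
  simp

theorem IsRealWave.inner_im {φ ψ : ModeC} (hφ : IsRealWave φ) (hψ : IsRealWave ψ) :
    (inner ℂ φ ψ).im = 0 := by
  rw [L2.inner_def, ← RCLike.im_eq_complex_im, ← integral_im (L2.integrable_inner (𝕜 := ℂ) φ ψ)]
  rw [← integral_zero ℝ ℝ (μ := volume)]
  refine integral_congr_ae ?_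
  filter_upwards [hφ, hψ] with x h1 h2
  simp [RCLike.inner_apply, h1, h2]

/-! ### The blocks of the phase error operator -/

theorem measurable_theta (μ β : ℝ) : Measurable (theta μ β) := by
  unfold theta
  fun_prop

/-! ### The twisting operation -/

/-- The reflection `sin θ Z + cos θ X`. -/
def reflection (θ : ℝ) : Matrix (Fin 2) (Fin 2) ℂ :=
  !![(Real.sin θ : ℂ), (Real.cos θ : ℂ); (Real.cos θ : ℂ), -(Real.sin θ : ℂ)]

theorem reflection_mul_self (θ : ℝ) : reflection θ * reflection θ = 1 := by
  have h : (Real.sin θ : ℂ) * Real.sin θ + Real.cos θ * Real.cos θ = 1 := by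
    rw [← Complex.ofReal_mul, ← Complex.ofReal_mul, ← Complex.ofReal_add, ← sq, ← sq,
      Real.sin_sq_add_cos_sq, Complex.ofReal_one]
  ext i j
  fin_cases i <;> fin_cases j <;>
    simp only [reflection, Matrix.mul_apply, Fin.sum_univ_two] <;> simp
  · simpa using h
  · ring
  · ring
  · rw [add_comm]
    simpa using h

theorem isSelfAdjoint_reflection (θ : ℝ) : IsSelfAdjoint (reflection θ) := by
  rw [IsSelfAdjoint, Matrix.star_eq_conjTranspose]
  ext i j
  fin_cases i <;> fin_cases j <;>
    simp only [reflection, Matrix.conjTranspose_apply, RCLike.star_def] <;>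
    simp [-Complex.ofReal_cos, -Complex.ofReal_sin]

/-- The sign of a Hermitian matrix `t + s W` with `W² = 1` and `|t| < s` is `W`. -/
theorem cfc_sign_of_involution {n : Type*} [Fintype n] [DecidableEq n] {W : Matrix n n ℂ}
    (hW : IsSelfAdjoint W) (hW2 : W * W = 1) {s t : ℝ} (hts : |t| < s) :
    cfc Real.sign (t • (1 : Matrix n n ℂ) + s • W) = W := by
  set T : Matrix n n ℂ := t • (1 : Matrix n n ℂ) + s • W with hT
  have hs : 0 < s := (abs_nonneg t).trans_lt hts
  have hTsa : IsSelfAdjoint T :=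
    ((IsSelfAdjoint.all t).smul (IsSelfAdjoint.one _)).add ((IsSelfAdjoint.all s).smul hW)
  -- (T - t)² = s², so the spectrum lies in {t - s, t + s}. These two points have opposite signs,
  -- and there sign agrees with the affine function (x - t)/s, which sends `T` to `W`.
  have hspec : ∀ x ∈ spectrum ℝ T, (x - t) ^ 2 = s ^ 2 := by
    intro x hx
    set p : Polynomial ℝ := (Polynomial.X - Polynomial.C t) ^ 2 - Polynomial.C (s ^ 2) with hp
    have h1 := spectrum.subset_polynomial_aeval T p ⟨x, hx, rfl⟩
    have h2 : Polynomial.aeval T p = 0 := by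
      have h3 : T - algebraMap ℝ (Matrix n n ℂ) t = s • W := by
        rw [Algebra.algebraMap_eq_smul_one, hT, add_sub_cancel_left]
      rw [hp, map_sub, map_pow, map_sub, Polynomial.aeval_X, Polynomial.aeval_C,
        Polynomial.aeval_C, h3, sq, smul_mul_smul_comm, hW2, Algebra.algebraMap_eq_smul_one, ← sq,
        sub_self]
    rw [h2] at h1
    have hne : Nontrivial (Matrix n n ℂ) := by
      by_contra hcon
      rw [not_nontrivial_iff_subsingleton] at hcon
      rw [spectrum.of_subsingleton] at h1
      exact h1
    rw [spectrum.zero_eq, Set.mem_singleton_iff] at h1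
    simpa [hp, sub_eq_zero] using h1
  have hsign : ∀ x ∈ spectrum ℝ T, Real.sign x = s⁻¹ * x + -(s⁻¹ * t) := by
    intro x hx
    obtain ⟨h1, h2⟩ := abs_lt.mp hts
    rcases sq_eq_sq_iff_eq_or_eq_neg.mp (hspec x hx) with h | h
    · rw [Real.sign_of_pos (by linarith), show x = s + t by linarith]
      field_simp
      ring
    · rw [Real.sign_of_neg (by linarith), show x = -s + t by linarith]
      field_simp
      ring
  rw [cfc_congr hsign, cfc_add_const _ _ _ , cfc_const_mul_id s⁻¹ T, hT, smul_add, smul_smul,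
    smul_smul, inv_mul_cancel₀ hs.ne', one_smul, Algebra.algebraMap_eq_smul_one, neg_smul]
  abel

theorem dyad_ket0 : dyad ket0 = !![1, 0; 0, 0] := by
  ext i j
  fin_cases i <;> fin_cases j <;> simp [dyad, ket0, Matrix.vecMulVec]

theorem dyad_ket1 : dyad ket1 = !![0, 0; 0, 1] := by
  ext i j
  fin_cases i <;> fin_cases j <;> simp [dyad, ket1, Matrix.vecMulVec]

theorem sqrt_two_inv_mul_self : ((Real.sqrt 2 : ℂ))⁻¹ * ((Real.sqrt 2 : ℂ))⁻¹ = 1 / 2 := by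
  rw [← mul_inv, ← Complex.ofReal_mul, Real.mul_self_sqrt (by norm_num)]
  norm_num

theorem dyad_ketPlus : dyad ketPlus = !![1 / 2, 1 / 2; 1 / 2, 1 / 2] := by
  have h := sqrt_two_inv_mul_self
  ext i j
  fin_cases i <;> fin_cases j <;>
    simp [dyad, ketPlus, Matrix.vecMulVec, -mul_inv_rev] <;> simpa using h

theorem dyad_ketMinus : dyad ketMinus = !![1 / 2, -(1 / 2); -(1 / 2), 1 / 2] := by
  have h := sqrt_two_inv_mul_self
  ext i j
  fin_cases i <;> fin_cases j <;>
    simp [dyad, ketMinus, Matrix.vecMulVec, -mul_inv_rev] <;> simpa using h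

/-- The off-diagonal entries of |±⟩⟨±| have opposite signs. On the diagonal the weights therefore
combine to (1 - q) - q = r. Off the diagonal the sign in `gaussVec` compensates, and they add up to
1. -/
theorem tauHom01_eq (μ β x : ℝ) {a b r : ℝ}
    (ha : a = Real.sqrt (ProbabilityTheory.gaussianPDFReal β (1 / 4) x))
    (hb : b = Real.sqrt (ProbabilityTheory.gaussianPDFReal (-β) (1 / 4) x))
    (hr : r = Real.exp (-2 * (μ - β ^ 2))) :
    tauHom01 μ β x = !![((r * a ^ 2 / 2 : ℝ) : ℂ), ((a * b / 2 : ℝ) : ℂ);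
      ((a * b / 2 : ℝ) : ℂ), ((r * b ^ 2 / 2 : ℝ) : ℂ)] := by
  subst ha hb
  ext i j
  simp only [tauHom01, tauHom, qParam, dyad_ketPlus, dyad_ketMinus, ← hr]
  fin_cases i <;> fin_cases j <;> simp [dyad, gaussVec, Matrix.vecMulVec] <;> ring

theorem sqrt_gaussianPDFReal_quarter (β x : ℝ) :
    Real.sqrt (ProbabilityTheory.gaussianPDFReal β (1 / 4) x) =
      Real.sqrt ((Real.sqrt (2 * Real.pi * (1 / 4)))⁻¹) * Real.exp (-(x - β) ^ 2) := by
  rw [ProbabilityTheory.gaussianPDFReal_def, Real.sqrt_mul (by positivity)]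
  congr 1
  rw [Real.sqrt_eq_iff_mul_self_eq (Real.exp_pos _).le (Real.exp_pos _).le, ← Real.exp_add]
  congr 1
  push_cast
  ring

/-- Subtracting half the trace leaves a multiple of sin θ Z + cos θ X, where tan θ = r(a² -
b²)/(2ab) = r sinh(4βx). The condition β² < μ gives r < 1, hence a negative determinant and one
eigenvalue of each sign. -/
theorem twistW_eq {μ β : ℝ} (hβμ : β ^ 2 < μ) (x : ℝ) :
    twistW μ β x = reflection (theta μ β x) := by
  obtain ⟨a, ha⟩ : ∃ a, a = Real.sqrt (ProbabilityTheory.gaussianPDFReal β (1 / 4) x) := ⟨_, rfl⟩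
  obtain ⟨b, hb⟩ : ∃ b, b = Real.sqrt (ProbabilityTheory.gaussianPDFReal (-β) (1 / 4) x) :=
    ⟨_, rfl⟩
  obtain ⟨r, hr⟩ : ∃ r, r = Real.exp (-2 * (μ - β ^ 2)) := ⟨_, rfl⟩
  have hr0 : 0 < r := hr ▸ Real.exp_pos _
  have hr1 : r < 1 := by
    rw [hr, Real.exp_lt_one_iff]
    linarith
  have ha0 : 0 < a := by
    rw [ha]
    exact Real.sqrt_pos.2 (ProbabilityTheory.gaussianPDFReal_pos _ _ _ (by norm_num))
  have hb0 : 0 < b := by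
    rw [hb]
    exact Real.sqrt_pos.2 (ProbabilityTheory.gaussianPDFReal_pos _ _ _ (by norm_num))
  have hsinh : 2 * a * b * Real.sinh (4 * β * x) = a ^ 2 - b ^ 2 := by
    have hA := ha
    have hB := hb
    rw [sqrt_gaussianPDFReal_quarter] at hA hB
    have e1 : a = b * Real.exp (4 * β * x) := by
      rw [hA, hB, mul_assoc _ (Real.exp _), ← Real.exp_add]
      congr 2
      ring
    have e2 : b = a * Real.exp (-(4 * β * x)) := by
      rw [e1, mul_assoc, ← Real.exp_add, add_neg_cancel, Real.exp_zero, mul_one]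
    rw [Real.sinh_eq]
    calc 2 * a * b * ((Real.exp (4 * β * x) - Real.exp (-(4 * β * x))) / 2)
        = a * (b * Real.exp (4 * β * x)) - b * (a * Real.exp (-(4 * β * x))) := by ring
      _ = a ^ 2 - b ^ 2 := by rw [← e1, ← e2]; ring
  obtain ⟨y, hy⟩ : ∃ y, y = r * Real.sinh (4 * β * x) := ⟨_, rfl⟩
  have hyab : 2 * a * b * y = r * (a ^ 2 - b ^ 2) := by rw [hy, ← hsinh]; ring
  have hθ : theta μ β x = Real.arctan y := by rw [theta, ← hr, ← hy]
  have hq0 : 0 < 1 + y ^ 2 := by positivity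
  have hq : 0 < Real.sqrt (1 + y ^ 2) := Real.sqrt_pos.2 hq0
  obtain ⟨s, hs⟩ : ∃ s, s = a * b * Real.sqrt (1 + y ^ 2) / 2 := ⟨_, rfl⟩
  have hs0 : 0 < s := by rw [hs]; positivity
  have hcos : s * Real.cos (theta μ β x) = a * b / 2 := by
    rw [hθ, Real.cos_arctan, hs]
    field_simp
  have hsin : s * Real.sin (theta μ β x) = r * (a ^ 2 - b ^ 2) / 4 := by
    rw [hθ, Real.sin_arctan, hs, ← hyab]
    field_simp
    ring
  -- Here s² - t² = (1 - r²)(ab)²/4, where t is half the trace.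
  have hts : |r * (a ^ 2 + b ^ 2) / 4| < s := by
    refine abs_lt_of_sq_lt_sq ?_ hs0.le
    have : s ^ 2 = (a * b / 2) ^ 2 + (r * (a ^ 2 - b ^ 2) / 4) ^ 2 := by
      rw [← hcos, ← hsin, mul_pow, mul_pow, ← mul_add, Real.cos_sq_add_sin_sq, mul_one]
    rw [this]
    have hr2 : r ^ 2 < 1 := by nlinarith
    have hab : 0 < (a * b) ^ 2 := by positivity
    nlinarith [mul_pos hab (sub_pos.2 hr2)]
  have hT : tauHom01 μ β x = (r * (a ^ 2 + b ^ 2) / 4) • (1 : Matrix (Fin 2) (Fin 2) ℂ) +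
      s • reflection (theta μ β x) := by
    rw [tauHom01_eq μ β x ha hb hr]
    ext i j
    fin_cases i <;> fin_cases j <;>
      simp only [reflection, Matrix.add_apply, Matrix.smul_apply, Complex.real_smul, Fin.zero_eta,
        Fin.mk_one, Matrix.of_apply, Matrix.cons_val', Matrix.cons_val_zero, Matrix.cons_val_one,
        Matrix.cons_val_fin_one, Matrix.one_apply, mul_neg, ← Complex.ofReal_mul, hcos, hsin] <;>
      simp <;> ring
  rw [twistW, hT]
  exact cfc_sign_of_involution (isSelfAdjoint_reflection _) (reflection_mul_self _) hts

/-- The reflection and the Pauli X of the controlled NOT multiply to a rotation, which acts on the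
component with B in |1⟩. -/
theorem twistV_mulVec {μ β : ℝ} (hβμ : β ^ 2 < μ) (x : ℝ) (v : Fin 2 × Fin 2 → ℂ) :
    twistV μ β x *ᵥ v = fun ab => !![v (0, 0), Real.cos (theta μ β x) * v (0, 1) +
        Real.sin (theta μ β x) * v (1, 1);
      v (1, 0), -Real.sin (theta μ β x) * v (0, 1) + Real.cos (theta μ β x) * v (1, 1)]
      ab.1 ab.2 := by
  rw [twistV, twistW_eq hβμ, ← Matrix.mulVec_mulVec]
  have h1 : cnotBA *ᵥ v = fun ab => !![v (0, 0), v (1, 1); v (1, 0), v (0, 1)] ab.1 ab.2 := by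
    ext ⟨a, b⟩
    fin_cases a <;> fin_cases b <;>
      simp [cnotBA, Matrix.mulVec, dotProduct, Fintype.sum_prod_type, Fin.sum_univ_two, dyad_ket0,
        dyad_ket1, pauliX, Matrix.one_apply]
  rw [h1]
  ext ⟨a, b⟩
  fin_cases a <;> fin_cases b <;>
    simp [Matrix.mulVec, dotProduct, Fintype.sum_prod_type, Fin.sum_univ_two, dyad_ket0,
        dyad_ket1, reflection, Matrix.one_apply, -Complex.ofReal_cos, -Complex.ofReal_sin] <;> ring

theorem one_kronecker_dyad_ketMinus_form (v w : Fin 2 × Fin 2 → ℂ) :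
    star v ⬝ᵥ (((1 : Matrix (Fin 2) (Fin 2) ℂ) ⊗ₖ dyad ketMinus) *ᵥ w) =
      1 / 2 * (star (v (0, 0) - v (0, 1)) * (w (0, 0) - w (0, 1)) +
        star (v (1, 0) - v (1, 1)) * (w (1, 0) - w (1, 1))) := by
  simp [Matrix.mulVec, dotProduct, Fintype.sum_prod_type, Fin.sum_univ_two, dyad_ketMinus,
    Matrix.one_apply]
  ring

/-- The Kraus operator stores ψ(x) and ψ(-x) in the two levels of B, so projecting on |-⟩ after the
twist leaves the difference of ψ(x) and the rotated ψ(-x). -/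
theorem phaseErrorForm_eq {f : ℝ → ℝ} {μ β : ℝ} (hβμ : β ^ 2 < μ) (hf_nonneg : ∀ x, 0 ≤ f x)
    (x : ℝ) (φ ψ : SpaceAC) :
    phaseErrorForm f μ β x φ ψ = 1 / 2 * f x *
      (star ((φ 0 : ℝ → ℂ) x - Real.cos (theta μ β x) * (φ 0 : ℝ → ℂ) (-x)
          - Real.sin (theta μ β x) * (φ 1 : ℝ → ℂ) (-x))
        * ((ψ 0 : ℝ → ℂ) x - Real.cos (theta μ β x) * (ψ 0 : ℝ → ℂ) (-x)
          - Real.sin (theta μ β x) * (ψ 1 : ℝ → ℂ) (-x))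
      + star ((φ 1 : ℝ → ℂ) x + Real.sin (theta μ β x) * (φ 0 : ℝ → ℂ) (-x)
          - Real.cos (theta μ β x) * (φ 1 : ℝ → ℂ) (-x))
        * ((ψ 1 : ℝ → ℂ) x + Real.sin (theta μ β x) * (ψ 0 : ℝ → ℂ) (-x)
          - Real.cos (theta μ β x) * (ψ 1 : ℝ → ℂ) (-x))) := by
  have hsq : ((Real.sqrt (f x) : ℝ) : ℂ) * (Real.sqrt (f x) : ℝ) = f x := by
    rw [← Complex.ofReal_mul, Real.mul_self_sqrt (hf_nonneg x)]
  rw [phaseErrorForm, ← Matrix.mulVec_mulVec, ← Matrix.mulVec_mulVec, Matrix.dotProduct_mulVec,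
    Matrix.vecMul_conjTranspose, star_star, one_kronecker_dyad_ketMinus_form,
    twistV_mulVec hβμ, twistV_mulVec hβμ, ← hsq]
  simp [krausHom, ket0, ket1, -Complex.ofReal_cos, -Complex.ofReal_sin]
  ring

/-! ### The blocks of the phase error operator -/

theorem IsOpIntegral.adjoint {H : Type*} [NormedAddCommGroup H] [InnerProductSpace ℂ H]
    [CompleteSpace H] {Q : ℝ → H → H → ℂ} {M : H →L[ℂ] H} (h : IsOpIntegral Q M) :
    IsOpIntegral (fun x φ ψ => star (Q x ψ φ)) (ContinuousLinearMap.adjoint M) := by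
  intro φ ψ
  refine ⟨?_, ?_⟩
  · have := (Complex.conjCLE : ℂ →L[ℝ] ℂ).integrable_comp (h ψ φ).1
    exact this
  · rw [ContinuousLinearMap.adjoint_inner_right, ← inner_conj_symm, (h ψ φ).2]
    exact integral_conj.symm

theorem IsOpIntegral.comp {H K : Type*} [NormedAddCommGroup H] [InnerProductSpace ℂ H]
    [CompleteSpace H] [NormedAddCommGroup K] [InnerProductSpace ℂ K] [CompleteSpace K]
    {Q : ℝ → H → H → ℂ} {M : H →L[ℂ] H} (h : IsOpIntegral Q M) (S T : K →L[ℂ] H) :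
    IsOpIntegral (fun x φ ψ => Q x (S φ) (T ψ))
      (ContinuousLinearMap.adjoint S ∘L M ∘L T) := fun φ ψ =>
  ⟨(h (S φ) (T ψ)).1, by
    rw [← (h (S φ) (T ψ)).2]
    simp [ContinuousLinearMap.adjoint_inner_right]⟩

theorem isBddMeas_mul {f h : ℝ → ℝ} (hf : Measurable f) (hf0 : ∀ x, 0 ≤ f x)
    (hf1 : ∀ x, f x ≤ 1) (hh : Measurable h) {C : ℝ} (hC : ∀ x, |h x| ≤ C) :
    IsBddMeas fun x => f x * h x := by
  refine ⟨hf.mul hh, C, fun x => ?_⟩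
  rw [abs_mul, abs_of_nonneg (hf0 x)]
  exact (mul_le_of_le_one_left (abs_nonneg _) (hf1 x)).trans (hC x)

theorem isOpIntegral_sandwichForm {h : ℝ → ℝ} (hh : IsBddMeas h) {P : ModeC →L[ℂ] ModeC}
    (hP : ContinuousLinearMap.adjoint P = P) (P' : ModeC →L[ℂ] ModeC) :
    IsOpIntegral (sandwichForm h P P') (P ∘L mulOp hh ∘L P') := by
  have := isOpIntegral_adjoint_mulOp hh P P'
  rw [hP] at this
  exact this

/-- The weights of the Kraus operators: a measurable function with values in `[0, 1]`, the sum of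
whose values at `x` and `-x` is at most `1`. -/
structure IsAcceptance (f : ℝ → ℝ) : Prop where
  meas : Measurable f
  nonneg : ∀ x, 0 ≤ f x
  add_neg_le : ∀ x, f x + f (-x) ≤ 1

namespace IsAcceptance

variable {f : ℝ → ℝ} (hf : IsAcceptance f) (μ β : ℝ)

theorem le_one (hf : IsAcceptance f) (x : ℝ) : f x ≤ 1 := by
  linarith [hf.add_neg_le x, hf.nonneg (-x)]

theorem bddOO (hf : IsAcceptance f) (μ β : ℝ) :
    IsBddMeas fun x => f x * (1 + Real.cos (theta μ β x)) := by
  have := measurable_theta μ β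
  refine isBddMeas_mul hf.meas hf.nonneg hf.le_one (by fun_prop) (C := 2) fun x => ?_
  rw [abs_le]
  constructor <;> linarith [Real.neg_one_le_cos (theta μ β x), Real.cos_le_one (theta μ β x)]

theorem bddEE (hf : IsAcceptance f) (μ β : ℝ) :
    IsBddMeas fun x => f x * (1 - Real.cos (theta μ β x)) := by
  have := measurable_theta μ β
  refine isBddMeas_mul hf.meas hf.nonneg hf.le_one (by fun_prop) (C := 2) fun x => ?_
  rw [abs_le]
  constructor <;> linarith [Real.neg_one_le_cos (theta μ β x), Real.cos_le_one (theta μ β x)]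

theorem bddOE (hf : IsAcceptance f) (μ β : ℝ) :
    IsBddMeas fun x => f x * Real.sin (theta μ β x) := by
  have := measurable_theta μ β
  exact isBddMeas_mul hf.meas hf.nonneg hf.le_one (by fun_prop) (C := 1)
    fun x => Real.abs_sin_le_one _

theorem opOO_eq : opOO f μ β = projOdd ∘L mulOp (hf.bddOO μ β) ∘L projOdd :=
  (isOpIntegral_sandwichForm (hf.bddOO μ β) adjoint_projOdd projOdd).opIntegral_eq

theorem opEE_eq : opEE f μ β = projEven ∘L mulOp (hf.bddEE μ β) ∘L projEven :=
  (isOpIntegral_sandwichForm (hf.bddEE μ β) adjoint_projEven projEven).opIntegral_eq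

theorem opOE_eq : opOE f μ β = projOdd ∘L mulOp (hf.bddOE μ β) ∘L projEven :=
  (isOpIntegral_sandwichForm (hf.bddOE μ β) adjoint_projOdd projEven).opIntegral_eq

theorem isOpIntegral_opOO (hf : IsAcceptance f) : IsOpIntegral (formOO f μ β) (opOO f μ β) :=
  (isOpIntegral_sandwichForm (hf.bddOO μ β) adjoint_projOdd projOdd).isOpIntegral_opIntegral

theorem isOpIntegral_opEE (hf : IsAcceptance f) : IsOpIntegral (formEE f μ β) (opEE f μ β) :=
  (isOpIntegral_sandwichForm (hf.bddEE μ β) adjoint_projEven projEven).isOpIntegral_opIntegral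

theorem isOpIntegral_opOE (hf : IsAcceptance f) : IsOpIntegral (formOE f μ β) (opOE f μ β) :=
  (isOpIntegral_sandwichForm (hf.bddOE μ β) adjoint_projOdd projEven).isOpIntegral_opIntegral

theorem isOpIntegral_neg_opOE (hf : IsAcceptance f) :
    IsOpIntegral (formOE' f μ β) (-opOE f μ β) := by
  have h := (hf.isOpIntegral_opOE μ β).const_mul (-1)
  rw [neg_one_smul] at h
  refine h.congr_ae fun φ ψ => Filter.Eventually.of_forall fun x => ?_
  simp only [formOE, formOE', sandwichForm]
  push_cast
  ring

theorem opEO_eq : opEO f μ β = projEven ∘L mulOp (hf.bddOE μ β) ∘L projOdd := by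
  rw [opEO, hf.opOE_eq, ContinuousLinearMap.adjoint_comp, ContinuousLinearMap.adjoint_comp,
    adjoint_projEven, adjoint_projOdd, adjoint_mulOp, ContinuousLinearMap.comp_assoc]

theorem inner_opOO_left (hf : IsAcceptance f) (φ ψ : ModeC) :
    inner ℂ (opOO f μ β φ) ψ = inner ℂ φ (opOO f μ β ψ) := by
  simp only [hf.opOO_eq, ContinuousLinearMap.comp_apply, inner_projOdd_left, inner_mulOp_left]

theorem inner_opEE_left (hf : IsAcceptance f) (φ ψ : ModeC) :
    inner ℂ (opEE f μ β φ) ψ = inner ℂ φ (opEE f μ β ψ) := by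
  simp only [hf.opEE_eq, ContinuousLinearMap.comp_apply, inner_projEven_left, inner_mulOp_left]

theorem isRealWave_opOO (hf : IsAcceptance f) {ψ : ModeC} (hψ : IsRealWave ψ) :
    IsRealWave (opOO f μ β ψ) := by
  rw [hf.opOO_eq]
  exact (hψ.projOdd.mulOp (hf.bddOO μ β)).projOdd

theorem isRealWave_opEE (hf : IsAcceptance f) {ψ : ModeC} (hψ : IsRealWave ψ) :
    IsRealWave (opEE f μ β ψ) := by
  rw [hf.opEE_eq]
  exact (hψ.projEven.mulOp (hf.bddEE μ β)).projEven

theorem isRealWave_opOE (hf : IsAcceptance f) {ψ : ModeC} (hψ : IsRealWave ψ) :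
    IsRealWave (opOE f μ β ψ) := by
  rw [hf.opOE_eq]
  exact (hψ.projEven.mulOp (hf.bddOE μ β)).projOdd

end IsAcceptance

/-! ### Each block is bounded by the identity -/

theorem theta_neg (μ β x : ℝ) : theta μ β (-x) = -theta μ β x := by
  simp [theta, Real.sinh_neg, Real.arctan_neg]

/-- The matrix with rows (1 + cos θ, sin θ) and (sin θ, 1 - cos θ) is twice the projection onto
(cos(θ/2), sin(θ/2)), which is why the proof passes to the half angle. -/
theorem two_block_density_bounds (o e : ℂ) (θ : ℝ) :
    0 ≤ (1 + Real.cos θ) * ‖o‖ ^ 2 + 2 * (Real.sin θ * (star o * e).re)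
        + (1 - Real.cos θ) * ‖e‖ ^ 2 ∧
      (1 + Real.cos θ) * ‖o‖ ^ 2 + 2 * (Real.sin θ * (star o * e).re)
        + (1 - Real.cos θ) * ‖e‖ ^ 2 ≤ 2 * (‖o‖ ^ 2 + ‖e‖ ^ 2) := by
  obtain ⟨t, rfl⟩ : ∃ t, θ = 2 * t := ⟨θ / 2, by ring⟩
  have hc := Real.cos_sq_add_sin_sq t
  rw [Real.cos_two_mul, Real.sin_two_mul, Complex.sq_norm, Complex.sq_norm,
    Complex.normSq_apply, Complex.normSq_apply]
  simp only [RCLike.star_def, Complex.mul_re, Complex.conj_re, Complex.conj_im]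
  generalize Real.cos t = c at *
  generalize Real.sin t = s at *
  have hs : 1 - (2 * c ^ 2 - 1) = 2 * s ^ 2 := by linarith
  have hs' : 1 + (2 * c ^ 2 - 1) = 2 * c ^ 2 := by ring
  rw [hs, hs']
  constructor
  · nlinarith [sq_nonneg (c * o.re + s * e.re), sq_nonneg (c * o.im + s * e.im)]
  · have h2 : (c ^ 2 + s ^ 2) * (o.re ^ 2 + o.im ^ 2 + e.re ^ 2 + e.im ^ 2) =
        o.re ^ 2 + o.im ^ 2 + e.re ^ 2 + e.im ^ 2 := by rw [hc, one_mul]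
    nlinarith [sq_nonneg (s * o.re - c * e.re), sq_nonneg (s * o.im - c * e.im)]

theorem integrable_norm_sq (ψ : ModeC) : Integrable fun x => ‖(ψ : ℝ → ℂ) x‖ ^ 2 :=
  (memLp_two_iff_integrable_sq_norm (Lp.aestronglyMeasurable ψ)).1 (Lp.memLp ψ)

theorem integral_norm_sq (ψ : ModeC) : ∫ x, ‖(ψ : ℝ → ℂ) x‖ ^ 2 = ‖ψ‖ ^ 2 := by
  rw [← inner_self_eq_norm_sq (𝕜 := ℂ), L2.inner_def, ← integral_re (L2.integrable_inner ψ ψ)]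
  refine integral_congr_ae (Filter.Eventually.of_forall fun x => ?_)
  simp only [inner_self_eq_norm_sq (𝕜 := ℂ)]

/-- The density `g` is even: sin θ and the odd part of `o` both change sign under x ↦ -x. Hence ∫ f
g = ½ ∫ (f(x) + f(-x)) g(x). Since g ≥ 0, the weight may be dropped before bounding `g` by twice the
norms. -/
theorem IsAcceptance.block_le {f : ℝ → ℝ} (hf : IsAcceptance f) (μ β : ℝ) (o e : ModeC) :
    (inner ℂ o (opOO f μ β o)).re + 2 * (inner ℂ o (opOE f μ β e)).re
      + (inner ℂ e (opEE f μ β e)).re ≤ ‖o‖ ^ 2 + ‖e‖ ^ 2 := by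
  set g : ℝ → ℝ := fun x => (1 + Real.cos (theta μ β x)) * ‖(projOdd o : ℝ → ℂ) x‖ ^ 2
      + 2 * (Real.sin (theta μ β x) *
        (star ((projOdd o : ℝ → ℂ) x) * (projEven e : ℝ → ℂ) x).re)
      + (1 - Real.cos (theta μ β x)) * ‖(projEven e : ℝ → ℂ) x‖ ^ 2 with hg
  have hre : ∀ z : ℂ, (star z * z).re = ‖z‖ ^ 2 := fun z => by
    rw [Complex.sq_norm, Complex.normSq_apply]
    simp
  have h1 := hf.isOpIntegral_opOO μ β o o
  have h2 := hf.isOpIntegral_opOE μ β o e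
  have h3 := hf.isOpIntegral_opEE μ β e e
  have hsplit : ∀ x, f x * g x = (formOO f μ β x o o).re + 2 * (formOE f μ β x o e).re
      + (formEE f μ β x e e).re := by
    intro x
    simp only [hg, formOO, formOE, formEE, sandwichForm, Complex.re_ofReal_mul, hre]
    ring
  have i1 : Integrable fun x => (formOO f μ β x o o).re := h1.1.re
  have i2 : Integrable fun x => 2 * (formOE f μ β x o e).re := h2.1.re.const_mul 2
  have i12 : Integrable fun x => (formOO f μ β x o o).re + 2 * (formOE f μ β x o e).re := i1.add i2
  have i3 : Integrable fun x => (formEE f μ β x e e).re := h3.1.re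
  have hi : Integrable fun x => f x * g x := by
    simp only [hsplit]
    exact i12.add i3
  have hint : (inner ℂ o (opOO f μ β o)).re + 2 * (inner ℂ o (opOE f μ β e)).re
      + (inner ℂ e (opEE f μ β e)).re = ∫ x, f x * g x := by
    simp only [hsplit]
    rw [integral_add i12 i3, integral_add i1 i2, integral_const_mul]
    have hr : ∀ {k : ℝ → ℂ}, Integrable k → ∫ x, (k x).re = (∫ x, k x).re :=
      fun hk => integral_re hk
    rw [h1.2, h2.2, h3.2, ← hr h1.1, ← hr h2.1, ← hr h3.1]
  have hgneg : ∀ᵐ x, g (-x) = g x := by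
    filter_upwards [coeFn_projOdd o, coeFn_projEven e, ae_neg (coeFn_projOdd o),
      ae_neg (coeFn_projEven e)] with x a1 a2 a3 a4
    have b1 : (projOdd o : ℝ → ℂ) (-x) = -(projOdd o : ℝ → ℂ) x := by
      rw [a1, a3, neg_neg]
      ring
    have b2 : (projEven e : ℝ → ℂ) (-x) = (projEven e : ℝ → ℂ) x := by
      rw [a2, a4, neg_neg]
      ring
    simp only [hg, theta_neg, Real.cos_neg, Real.sin_neg, b1, b2, norm_neg, star_neg, neg_mul,
      Complex.neg_re, mul_neg, neg_neg]
  have hi' : Integrable fun x => f (-x) * g x := by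
    refine hi.comp_neg.congr ?_
    filter_upwards [hgneg] with x hx
    rw [hx]
  have heq : ∫ x, f (-x) * g x = ∫ x, f x * g x := by
    rw [← integral_neg_eq_self (fun x => f x * g x)]
    refine integral_congr_ae ?_
    filter_upwards [hgneg] with x hx
    rw [hx]
  have hle : ∫ x, (f x * g x + f (-x) * g x) ≤
      ∫ x, 2 * (‖(projOdd o : ℝ → ℂ) x‖ ^ 2 + ‖(projEven e : ℝ → ℂ) x‖ ^ 2) := by
    refine integral_mono (hi.add hi')
      (((integrable_norm_sq _).add (integrable_norm_sq _)).const_mul 2) fun x => ?_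
    obtain ⟨c1, c2⟩ := two_block_density_bounds ((projOdd o : ℝ → ℂ) x)
      ((projEven e : ℝ → ℂ) x) (theta μ β x)
    have c3 : (f x + f (-x)) * g x ≤ g x := mul_le_of_le_one_left c1 (hf.add_neg_le x)
    show f x * g x + f (-x) * g x ≤ _
    rw [← add_mul]
    exact c3.trans c2
  rw [integral_add hi hi', heq, integral_const_mul,
    integral_add (integrable_norm_sq _) (integrable_norm_sq _), integral_norm_sq,
    integral_norm_sq] at hle
  rw [hint]
  have n1 := norm_sq_projOdd_add_norm_sq_projEven o
  have n2 := norm_sq_projOdd_add_norm_sq_projEven e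
  -- The even part of `o` and the odd part of `e` do not enter the left-hand side; they only enlarge
  -- the right.
  nlinarith [sq_nonneg ‖projEven o‖, sq_nonneg ‖projOdd e‖]

/-! ### The decomposition of the phase error operator -/

/-- `ψ ↦ √2 ⟨+|ψ`. -/
def plusMap : SpaceAC →L[ℂ] ModeC :=
  PiLp.proj (𝕜 := ℂ) 2 (fun _ : Fin 2 => ModeC) 0 + PiLp.proj (𝕜 := ℂ) 2 (fun _ : Fin 2 => ModeC) 1

/-- `ψ ↦ √2 ⟨-|ψ`. -/
def minusMap : SpaceAC →L[ℂ] ModeC :=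
  PiLp.proj (𝕜 := ℂ) 2 (fun _ : Fin 2 => ModeC) 0 - PiLp.proj (𝕜 := ℂ) 2 (fun _ : Fin 2 => ModeC) 1

theorem plusMap_apply (ψ : SpaceAC) : plusMap ψ = ψ 0 + ψ 1 := rfl

theorem minusMap_apply (ψ : SpaceAC) : minusMap ψ = ψ 0 - ψ 1 := rfl

theorem norm_sq_plusMap_add_norm_sq_minusMap (ψ : SpaceAC) :
    ‖plusMap ψ‖ ^ 2 + ‖minusMap ψ‖ ^ 2 = 2 * ‖ψ‖ ^ 2 := by
  rw [plusMap_apply, minusMap_apply, PiLp.norm_sq_eq_of_L2, Fin.sum_univ_two]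
  have := parallelogram_law_with_norm ℂ (ψ 0) (ψ 1)
  nlinarith [this]

/-- Twice the phase error operator, as the sum of its two blocks. -/
def blockSum (f : ℝ → ℝ) (μ β : ℝ) : SpaceAC →L[ℂ] SpaceAC :=
  ContinuousLinearMap.adjoint plusMap ∘L opOO f μ β ∘L plusMap
    + ContinuousLinearMap.adjoint plusMap ∘L opOE f μ β ∘L minusMap
    + ContinuousLinearMap.adjoint minusMap ∘L opEO f μ β ∘L plusMap
    + ContinuousLinearMap.adjoint minusMap ∘L opEE f μ β ∘L minusMap
    + (ContinuousLinearMap.adjoint minusMap ∘L opOO f μ β ∘L minusMap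
    + (-1 : ℂ) • (ContinuousLinearMap.adjoint minusMap ∘L opOE f μ β ∘L plusMap)
    + (-1 : ℂ) • (ContinuousLinearMap.adjoint plusMap ∘L opEO f μ β ∘L minusMap)
    + ContinuousLinearMap.adjoint plusMap ∘L opEE f μ β ∘L plusMap)

/-- The integrands agree almost everywhere, with no symmetrization of `f`. In the difference vector
a rotation by θ mixes |+⟩ and |-⟩ only through sin θ, while cos θ preserves them, which yields the
two blocks. -/
theorem IsAcceptance.isOpIntegral_phaseErrorForm {f : ℝ → ℝ} (hf : IsAcceptance f) {μ β : ℝ}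
    (hβμ : β ^ 2 < μ) :
    IsOpIntegral (phaseErrorForm f μ β) ((1 / 2 : ℂ) • blockSum f μ β) := by
  have hoo := hf.isOpIntegral_opOO μ β
  have hoe := hf.isOpIntegral_opOE μ β
  have heo : IsOpIntegral _ (opEO f μ β) := hoe.adjoint
  have hee := hf.isOpIntegral_opEE μ β
  have h := (((((hoo.comp plusMap plusMap).add (hoe.comp plusMap minusMap)).add
    (heo.comp minusMap plusMap)).add (hee.comp minusMap minusMap)).add
    ((((hoo.comp minusMap minusMap).add ((hoe.comp minusMap plusMap).const_mul (-1))).add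
    ((heo.comp plusMap minusMap).const_mul (-1))).add (hee.comp plusMap plusMap))).const_mul (1 / 2)
  refine h.congr_ae fun φ ψ => ?_
  have hcoe : ∀ χ : SpaceAC, ∀ᵐ x, (projOdd (plusMap χ) : ℝ → ℂ) x =
        1 / 2 * ((χ 0 : ℝ → ℂ) x + (χ 1 : ℝ → ℂ) x - ((χ 0 : ℝ → ℂ) (-x) + (χ 1 : ℝ → ℂ) (-x))) ∧
      (projEven (plusMap χ) : ℝ → ℂ) x =
        1 / 2 * ((χ 0 : ℝ → ℂ) x + (χ 1 : ℝ → ℂ) x + ((χ 0 : ℝ → ℂ) (-x) + (χ 1 : ℝ → ℂ) (-x))) ∧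
      (projOdd (minusMap χ) : ℝ → ℂ) x =
        1 / 2 * ((χ 0 : ℝ → ℂ) x - (χ 1 : ℝ → ℂ) x - ((χ 0 : ℝ → ℂ) (-x) - (χ 1 : ℝ → ℂ) (-x))) ∧
      (projEven (minusMap χ) : ℝ → ℂ) x =
        1 / 2 * ((χ 0 : ℝ → ℂ) x - (χ 1 : ℝ → ℂ) x
          + ((χ 0 : ℝ → ℂ) (-x) - (χ 1 : ℝ → ℂ) (-x))) := by
    intro χ
    filter_upwards [coeFn_projOdd (plusMap χ), coeFn_projEven (plusMap χ),
      coeFn_projOdd (minusMap χ), coeFn_projEven (minusMap χ),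
      Lp.coeFn_add (χ 0) (χ 1), ae_neg (Lp.coeFn_add (χ 0) (χ 1)),
      Lp.coeFn_sub (χ 0) (χ 1), ae_neg (Lp.coeFn_sub (χ 0) (χ 1))] with x a1 a2 a3 a4 b1 b2 b3 b4
    rw [a1, a2, a3, a4, plusMap_apply, minusMap_apply, b1, b2, b3, b4]
    exact ⟨rfl, rfl, rfl, rfl⟩
  filter_upwards [hcoe φ, hcoe ψ] with x ⟨p1, p2, p3, p4⟩ ⟨q1, q2, q3, q4⟩
  have hcs : (Real.cos (theta μ β x) : ℂ) ^ 2 + (Real.sin (theta μ β x) : ℂ) ^ 2 = 1 := by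
    rw [← Complex.ofReal_pow, ← Complex.ofReal_pow, ← Complex.ofReal_add,
      Real.cos_sq_add_sin_sq, Complex.ofReal_one]
  rw [phaseErrorForm_eq hβμ hf.nonneg]
  simp only [formOO, formOE, formEE, sandwichForm, p1, p2, p3, p4, q1, q2, q3, q4,
    RCLike.star_def, map_mul, map_add, map_sub, map_div₀, map_one, map_ofNat, Complex.conj_ofReal,
    Complex.conj_conj]
  push_cast [-Complex.ofReal_cos, -Complex.ofReal_sin]
  generalize (Real.cos (theta μ β x) : ℂ) = c at *
  generalize (Real.sin (theta μ β x) : ℂ) = s at *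
  -- Only the terms quadratic in the values at -x need cos² + sin² = 1, i.e. that the rotation is an
  -- isometry.
  linear_combination (-(1 / 2 : ℂ) * f x *
    ((starRingEnd ℂ) ((φ 0 : ℝ → ℂ) (-x)) * (ψ 0 : ℝ → ℂ) (-x) +
     (starRingEnd ℂ) ((φ 1 : ℝ → ℂ) (-x)) * (ψ 1 : ℝ → ℂ) (-x))) * hcs

theorem IsAcceptance.phaseErrorOp_eq {f : ℝ → ℝ} (hf : IsAcceptance f) {μ β : ℝ}
    (hβμ : β ^ 2 < μ) : phaseErrorOp f μ β = (1 / 2 : ℂ) • blockSum f μ β :=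
  (hf.isOpIntegral_phaseErrorForm hβμ).opIntegral_eq

/-! ### Compression of a two-block operator to six dimensions -/

section Frame

variable {H : Type*} [NormedAddCommGroup H] [InnerProductSpace ℂ H]

theorem norm_sq_sub_inner_smul {u : H} (hu : ‖u‖ = 1 ∨ u = 0) (v : H) :
    ‖v - inner ℂ u v • u‖ ^ 2 = ‖v‖ ^ 2 - ‖inner ℂ u v‖ ^ 2 := by
  rcases hu with hu | rfl
  · rw [norm_sub_sq (𝕜 := ℂ), inner_smul_right, norm_smul, hu, ← inner_conj_symm v u,
      RCLike.mul_conj, ← RCLike.ofReal_pow, RCLike.ofReal_re]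
    ring
  · simp

/-- Bessel's inequality for three orthogonal vectors, each of which is a unit vector or zero. -/
theorem bessel_three {p u w : H} (hp : ‖p‖ = 1 ∨ p = 0) (hu : ‖u‖ = 1 ∨ u = 0)
    (hw : ‖w‖ = 1 ∨ w = 0) (hpu : inner ℂ u p = 0) (hpw : inner ℂ w p = 0)
    (huw : inner ℂ w u = 0) (v : H) :
    ‖inner ℂ p v‖ ^ 2 + ‖inner ℂ u v‖ ^ 2 + ‖inner ℂ w v‖ ^ 2 ≤ ‖v‖ ^ 2 := by
  have h1 := norm_sq_sub_inner_smul hp v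
  have h2 := norm_sq_sub_inner_smul hu (v - inner ℂ p v • p)
  have h3 := norm_sq_sub_inner_smul hw
    (v - inner ℂ p v • p - inner ℂ u (v - inner ℂ p v • p) • u)
  simp only [inner_sub_right, inner_smul_right, hpu, hpw, huw, mul_zero, sub_zero] at h1 h2 h3
  have h4 := sq_nonneg ‖v - inner ℂ p v • p - inner ℂ u v • u - inner ℂ w v • w‖
  linarith

/-- Since 0⁻¹ = 0, normalizing the zero vector gives zero, so degenerate frames need no separate
treatment. -/
theorem norm_inv_smul_self (a : H) :
    (‖((‖a‖⁻¹ : ℝ) : ℂ) • a‖ = 1 ∨ ((‖a‖⁻¹ : ℝ) : ℂ) • a = 0) ∧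
      a = ((‖a‖ : ℝ) : ℂ) • ((‖a‖⁻¹ : ℝ) : ℂ) • a := by
  by_cases ha : a = 0
  · simp [ha]
  · have hn : ‖a‖ ≠ 0 := norm_ne_zero_iff.2 ha
    refine ⟨Or.inl ?_, ?_⟩
    · rw [norm_smul, Complex.norm_real, norm_inv, norm_norm, inv_mul_cancel₀ hn]
    · rw [smul_smul, ← Complex.ofReal_mul, mul_inv_cancel₀ hn, Complex.ofReal_one, one_smul]

/-- The Gram-Schmidt process for two vectors `a`, `b` relative to a unit vector `p`, with vectors
that may vanish in place of orthonormal ones. -/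
theorem exists_gramSchmidt_frame {p a b : H} {l m n σ s δ : ℝ} (hp : ‖p‖ = 1)
    (hl : inner ℂ p a = l) (hm : inner ℂ p b = m) (hn : inner ℂ a b = n)
    (hσ : σ = Real.sqrt (‖a‖ ^ 2 - l ^ 2)) (hs : s = σ⁻¹ * (n - l * m))
    (hδ : δ = Real.sqrt (‖b‖ ^ 2 - m ^ 2 - s ^ 2)) :
    ∃ u w : H, a = (l : ℂ) • p + (σ : ℂ) • u ∧ b = (m : ℂ) • p + (s : ℂ) • u + (δ : ℂ) • w ∧
      inner ℂ u p = 0 ∧ inner ℂ w p = 0 ∧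
      ∀ v : H, ‖inner ℂ p v‖ ^ 2 + ‖inner ℂ u v‖ ^ 2 + ‖inner ℂ w v‖ ^ 2 ≤ ‖v‖ ^ 2 := by
  have hpp : inner ℂ p p = (1 : ℂ) := by
    rw [inner_self_eq_norm_sq_to_K, hp]
    norm_num
  have hap : inner ℂ a p = (l : ℂ) := by rw [← inner_conj_symm, hl, Complex.conj_ofReal]
  have hbp : inner ℂ b p = (m : ℂ) := by rw [← inner_conj_symm, hm, Complex.conj_ofReal]
  set a' := a - (l : ℂ) • p with ha'
  have hna : ‖a'‖ = σ := by
    have := norm_sq_sub_inner_smul (Or.inl hp) a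
    rw [hl, Complex.norm_real, Real.norm_eq_abs, sq_abs] at this
    rw [hσ, ← this, Real.sqrt_sq (norm_nonneg _)]
  set b' := b - (m : ℂ) • p with hb'
  have hnb : ‖b'‖ ^ 2 = ‖b‖ ^ 2 - m ^ 2 := by
    have := norm_sq_sub_inner_smul (Or.inl hp) b
    rwa [hm, Complex.norm_real, Real.norm_eq_abs, sq_abs] at this
  have ha'p : inner ℂ a' p = 0 := by
    rw [ha', inner_sub_left, inner_smul_left, hpp, hap, Complex.conj_ofReal, mul_one, sub_self]
  have hb'p : inner ℂ b' p = 0 := by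
    rw [hb', inner_sub_left, inner_smul_left, hpp, hbp, Complex.conj_ofReal, mul_one, sub_self]
  have hab' : inner ℂ a' b' = ((n - l * m : ℝ) : ℂ) := by
    rw [hb', inner_sub_right, inner_smul_right, ha'p, ha', inner_sub_left, inner_smul_left, hn, hm,
      Complex.conj_ofReal]
    push_cast
    ring
  obtain ⟨hu, hau⟩ := norm_inv_smul_self a'
  set u := ((‖a'‖⁻¹ : ℝ) : ℂ) • a' with hu_def
  have hup : inner ℂ u p = 0 := by rw [hu_def, inner_smul_left, ha'p, mul_zero]
  -- This also holds for σ = 0: both sides are then 0, because the inverse of 0 is 0. It matches the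
  -- convention for σ_oe and σ_ee.
  have hub : inner ℂ u b' = (s : ℂ) := by
    rw [hu_def, inner_smul_left, hab', Complex.conj_ofReal, hna, ← Complex.ofReal_mul, hs]
  set b'' := b' - (s : ℂ) • u with hb''
  have hnb'' : ‖b''‖ = δ := by
    have := norm_sq_sub_inner_smul hu b'
    rw [hub, Complex.norm_real, Real.norm_eq_abs, sq_abs, hnb] at this
    rw [hδ, ← this, Real.sqrt_sq (norm_nonneg _)]
  obtain ⟨hw, hbw⟩ := norm_inv_smul_self b''
  set w := ((‖b''‖⁻¹ : ℝ) : ℂ) • b'' with hw_def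
  have hb''u : inner ℂ b'' u = 0 := by
    have hbu : inner ℂ b' u = (s : ℂ) := by rw [← inner_conj_symm, hub, Complex.conj_ofReal]
    rw [hb'', inner_sub_left, inner_smul_left, hbu, Complex.conj_ofReal]
    -- If `u` vanishes, then so does `s`, being the inner product of `u` with `b'`.
    rcases hu with hu1 | hu0
    · rw [inner_self_eq_norm_sq_to_K, hu1]
      norm_num
    · rw [hu0, inner_zero_right] at hbu
      rw [← hbu]
      ring
  have hwp : inner ℂ w p = 0 := by
    rw [hw_def, inner_smul_left, hb'', inner_sub_left, inner_smul_left, hb'p, hup]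
    simp
  have hwu : inner ℂ w u = 0 := by rw [hw_def, inner_smul_left, hb''u, mul_zero]
  refine ⟨u, w, ?_, ?_, hup, hwp, bessel_three (Or.inl hp) hu hw hup hwp hwu⟩
  · rw [← hna, ← hau, ha', add_sub_cancel]
  · rw [← hnb'', ← hbw, hb'', hb']
    abel

/-- A quadratic form on two blocks, bounded by the identity, is bounded by its compression to
the six-dimensional space that contains two vectors and their images. -/
theorem two_block_form_le {A B B' D : H →L[ℂ] H}
    (hA : ∀ x y, inner ℂ (A x) y = inner ℂ x (A y))
    (hB : ∀ x y, inner ℂ (B' x) y = inner ℂ x (B y))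
    (hD : ∀ x y, inner ℂ (D x) y = inner ℂ x (D y))
    (hle : ∀ o e, (inner ℂ o (A o)).re + 2 * (inner ℂ o (B e)).re + (inner ℂ e (D e)).re
      ≤ ‖o‖ ^ 2 + ‖e‖ ^ 2)
    {p u₁ u₂ k w₁ w₂ : H} {loo loe lee soo soe seo see doe dee : ℝ}
    (hp : ‖p‖ = 1) (hk : ‖k‖ = 1)
    (hAp : A p = (loo : ℂ) • p + (soo : ℂ) • u₁)
    (hBk : B k = (loe : ℂ) • p + (soe : ℂ) • u₁ + (doe : ℂ) • u₂)
    (hBp : B' p = (loe : ℂ) • k + (seo : ℂ) • w₁)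
    (hDk : D k = (lee : ℂ) • k + (see : ℂ) • w₁ + (dee : ℂ) • w₂)
    (hu₁ : inner ℂ u₁ p = 0) (hu₂ : inner ℂ u₂ p = 0)
    (hw₁ : inner ℂ w₁ k = 0) (hw₂ : inner ℂ w₂ k = 0)
    (hbo : ∀ v : H, ‖inner ℂ p v‖ ^ 2 + ‖inner ℂ u₁ v‖ ^ 2 + ‖inner ℂ u₂ v‖ ^ 2 ≤ ‖v‖ ^ 2)
    (hbe : ∀ v : H, ‖inner ℂ k v‖ ^ 2 + ‖inner ℂ w₁ v‖ ^ 2 + ‖inner ℂ w₂ v‖ ^ 2 ≤ ‖v‖ ^ 2)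
    {κ γo γe a b c : ℝ}
    (hform : ∀ v : Fin 6 → ℝ,
      (1 - γo) * v 0 ^ 2 + (1 - γo) * v 1 ^ 2 + (κ * a ^ 2 + loo - γo) * v 2 ^ 2
        + (κ * b ^ 2 + lee - γe) * v 3 ^ 2 + (1 - γe) * v 4 ^ 2 + (1 - γe) * v 5 ^ 2
        + 2 * (doe * v 0 * v 3 + soo * v 1 * v 2 + soe * v 1 * v 3
          + (κ * (a * b) + loe) * v 2 * v 3 + seo * v 2 * v 4 + see * v 3 * v 4
          + dee * v 3 * v 5)
      ≤ c * (v 0 ^ 2 + v 1 ^ 2 + v 2 ^ 2 + v 3 ^ 2 + v 4 ^ 2 + v 5 ^ 2)) (o e : H) :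
    (inner ℂ o (A o)).re + 2 * (inner ℂ o (B e)).re + (inner ℂ e (D e)).re
      + κ * ‖(a : ℂ) * inner ℂ p o + (b : ℂ) * inner ℂ k e‖ ^ 2
      - γo * ‖o‖ ^ 2 - γe * ‖e‖ ^ 2 ≤ c * (‖o‖ ^ 2 + ‖e‖ ^ 2) := by
  obtain ⟨x, hx⟩ : ∃ x : ℂ, x = inner ℂ p o := ⟨_, rfl⟩
  obtain ⟨y, hy⟩ : ∃ y : ℂ, y = inner ℂ k e := ⟨_, rfl⟩
  obtain ⟨c₁, hc₁⟩ : ∃ z : ℂ, z = inner ℂ u₁ o := ⟨_, rfl⟩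
  obtain ⟨c₂, hc₂⟩ : ∃ z : ℂ, z = inner ℂ u₂ o := ⟨_, rfl⟩
  obtain ⟨d₁, hd₁⟩ : ∃ z : ℂ, z = inner ℂ w₁ e := ⟨_, rfl⟩
  obtain ⟨d₂, hd₂⟩ : ∃ z : ℂ, z = inner ℂ w₂ e := ⟨_, rfl⟩
  have hpp : inner ℂ p p = (1 : ℂ) := by
    rw [inner_self_eq_norm_sq_to_K, hp]
    norm_num
  have hkk : inner ℂ k k = (1 : ℂ) := by
    rw [inner_self_eq_norm_sq_to_K, hk]
    norm_num
  -- Only the components along `p` and `k` are split off. The cross terms between these and the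
  -- remainders see only the coordinates c₁, c₂, d₁, d₂; the terms in the remainders alone are
  -- bounded through `hle`.
  set o' := o - x • p with ho'
  set e' := e - y • k with he'
  have hno : ‖o'‖ ^ 2 = ‖o‖ ^ 2 - ‖x‖ ^ 2 := by
    rw [ho', hx]
    exact norm_sq_sub_inner_smul (Or.inl hp) o
  have hne : ‖e'‖ ^ 2 = ‖e‖ ^ 2 - ‖y‖ ^ 2 := by
    rw [he', hy]
    exact norm_sq_sub_inner_smul (Or.inl hk) e
  have ho : o = x • p + o' := by rw [ho']; abel
  have he : e = y • k + e' := by rw [he']; abel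
  have conj_zero : ∀ {v w : H}, inner ℂ v w = 0 → inner ℂ w v = 0 := fun h => by
    rw [← inner_conj_symm, h, map_zero]
  have hpo' : inner ℂ p o' = 0 := by
    rw [ho', inner_sub_right, inner_smul_right, hpp, ← hx, mul_one, sub_self]
  have hke' : inner ℂ k e' = 0 := by
    rw [he', inner_sub_right, inner_smul_right, hkk, ← hy, mul_one, sub_self]
  have hu₁o : inner ℂ o' u₁ = star c₁ := by
    rw [ho', inner_sub_left, inner_smul_left, conj_zero hu₁, hc₁, mul_zero, sub_zero]
    exact (inner_conj_symm _ _).symm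
  have hu₂o : inner ℂ o' u₂ = star c₂ := by
    rw [ho', inner_sub_left, inner_smul_left, conj_zero hu₂, hc₂, mul_zero, sub_zero]
    exact (inner_conj_symm _ _).symm
  have hw₁e : inner ℂ e' w₁ = star d₁ := by
    rw [he', inner_sub_left, inner_smul_left, conj_zero hw₁, hd₁, mul_zero, sub_zero]
    exact (inner_conj_symm _ _).symm
  have hw₂e : inner ℂ e' w₂ = star d₂ := by
    rw [he', inner_sub_left, inner_smul_left, conj_zero hw₂, hd₂, mul_zero, sub_zero]
    exact (inner_conj_symm _ _).symm
  have eA1 : inner ℂ p (A p) = (loo : ℂ) := by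
    rw [hAp, inner_add_right, inner_smul_right, inner_smul_right, hpp, conj_zero hu₁]
    ring
  have eA2 : inner ℂ o' (A p) = soo * star c₁ := by
    rw [hAp, inner_add_right, inner_smul_right, inner_smul_right, conj_zero hpo', hu₁o]
    ring
  have eA3 : inner ℂ p (A o') = soo * c₁ := by
    rw [← hA, ← inner_conj_symm, eA2]
    simp
  have eB1 : inner ℂ p (B k) = (loe : ℂ) := by
    rw [hBk, inner_add_right, inner_add_right, inner_smul_right, inner_smul_right,
      inner_smul_right, hpp, conj_zero hu₁, conj_zero hu₂]
    ring
  have eB2 : inner ℂ o' (B k) = soe * star c₁ + doe * star c₂ := by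
    rw [hBk, inner_add_right, inner_add_right, inner_smul_right, inner_smul_right,
      inner_smul_right, conj_zero hpo', hu₁o, hu₂o]
    ring
  have eB3 : inner ℂ p (B e') = seo * d₁ := by
    rw [← hB, hBp, inner_add_left, inner_smul_left, inner_smul_left, hke', ← inner_conj_symm w₁,
      hw₁e]
    simp
  have eD1 : inner ℂ k (D k) = (lee : ℂ) := by
    rw [hDk, inner_add_right, inner_add_right, inner_smul_right, inner_smul_right,
      inner_smul_right, hkk, conj_zero hw₁, conj_zero hw₂]
    ring
  have eD2 : inner ℂ e' (D k) = see * star d₁ + dee * star d₂ := by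
    rw [hDk, inner_add_right, inner_add_right, inner_smul_right, inner_smul_right,
      inner_smul_right, conj_zero hke', hw₁e, hw₂e]
    ring
  have eD3 : inner ℂ k (D e') = see * d₁ + dee * d₂ := by
    rw [← hD, ← inner_conj_symm, eD2]
    simp
  have expA : inner ℂ o (A o) = star x * x * loo + star x * (soo * c₁) + x * (soo * star c₁)
      + inner ℂ o' (A o') := by
    nth_rewrite 1 [ho]
    rw [ho, map_add, map_smul]
    simp only [inner_add_left, inner_add_right, inner_smul_left, inner_smul_right, eA1, eA2, eA3,
      RCLike.star_def]
    ring
  have expB : inner ℂ o (B e) = star x * y * loe + star x * (seo * d₁)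
      + y * (soe * star c₁ + doe * star c₂) + inner ℂ o' (B e') := by
    rw [ho, he, map_add, map_smul]
    simp only [inner_add_left, inner_add_right, inner_smul_left, inner_smul_right, eB1, eB2, eB3,
      RCLike.star_def]
    ring
  have expD : inner ℂ e (D e) = star y * y * lee + star y * (see * d₁ + dee * d₂)
      + y * (see * star d₁ + dee * star d₂) + inner ℂ e' (D e') := by
    nth_rewrite 1 [he]
    rw [he, map_add, map_smul]
    simp only [inner_add_left, inner_add_right, inner_smul_left, inner_smul_right, eD1, eD2, eD3,
      RCLike.star_def]
    ring
  -- Testing on the outer basis vectors shows that `c` dominates the diagonal entries 1 - γo and 1 -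
  -- γe, as needed for the directions outside the six-dimensional space.
  have hco := hform ![1, 0, 0, 0, 0, 0]
  have hce := hform ![0, 0, 0, 0, 0, 1]
  simp only [Matrix.cons_val] at hco hce
  replace hco : 1 - γo ≤ c := by linarith
  replace hce : 1 - γe ≤ c := by linarith
  have h1 := hle o' e'
  -- The matrix is real, so its form on complex coordinates is the sum of its values on the real and
  -- imaginary parts.
  have h2 := hform ![c₂.re, c₁.re, x.re, y.re, d₁.re, d₂.re]
  have h3 := hform ![c₂.im, c₁.im, x.im, y.im, d₁.im, d₂.im]
  -- The Bessel defects are the squared norms left over outside the frames; they are paid for by c -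
  -- (1 - γo) and c - (1 - γe).
  have h4 := mul_nonneg (sub_nonneg.2 hco) (sub_nonneg.2 (hbo o))
  have h5 := mul_nonneg (sub_nonneg.2 hce) (sub_nonneg.2 (hbe e))
  rw [expA, expB, expD, ← hx, ← hy]
  rw [← hx, ← hc₁, ← hc₂] at h4
  rw [← hy, ← hd₁, ← hd₂] at h5
  rw [hno, hne] at h1
  have nsq : ∀ z : ℂ, ‖z‖ ^ 2 = z.re ^ 2 + z.im ^ 2 := fun z => by
    rw [Complex.sq_norm, Complex.normSq_apply]
    ring
  rw [nsq x, nsq y] at h1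
  rw [nsq x, nsq c₁, nsq c₂] at h4
  rw [nsq y, nsq d₁, nsq d₂] at h5
  rw [nsq ((a : ℂ) * x + b * y)]
  simp only [Complex.add_re, Complex.add_im, Complex.mul_re, Complex.mul_im, Complex.ofReal_re,
    Complex.ofReal_im, RCLike.star_def, Complex.conj_re, Complex.conj_im]
  simp only [Matrix.cons_val] at h2 h3
  linear_combination h1 + h2 + h3 + h4 + h5

end Frame

/-! ### The largest eigenvalue of a symmetric matrix -/

theorem spectrum_nonempty_of_isHermitian {M : Matrix (Fin 6) (Fin 6) ℝ} (hM : M.IsHermitian) :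
    (spectrum ℝ M).Nonempty := by
  rw [hM.spectrum_real_eq_range_eigenvalues]
  exact Set.range_nonempty _

theorem spectrum_finite (M : Matrix (Fin 6) (Fin 6) ℝ) : (spectrum ℝ M).Finite :=
  Matrix.finite_real_spectrum

theorem dotProduct_mulVec_le_specSup {M : Matrix (Fin 6) (Fin 6) ℝ} (hM : M.IsHermitian)
    (v : Fin 6 → ℝ) : v ⬝ᵥ (M *ᵥ v) ≤ specSup M * (v ⬝ᵥ v) := by
  have hH : (algebraMap ℝ (Matrix (Fin 6) (Fin 6) ℝ) (specSup M) - M).IsHermitian := by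
    refine Matrix.IsHermitian.sub ?_ hM
    rw [Algebra.algebraMap_eq_smul_one]
    simp [Matrix.IsHermitian]
  have hP : (algebraMap ℝ (Matrix (Fin 6) (Fin 6) ℝ) (specSup M) - M).PosSemidef := by
    rw [hH.posSemidef_iff_eigenvalues_nonneg]
    intro i
    have hi : hH.eigenvalues i ∈
        spectrum ℝ (algebraMap ℝ (Matrix (Fin 6) (Fin 6) ℝ) (specSup M) - M) := by
      rw [hH.spectrum_real_eq_range_eigenvalues]
      exact ⟨i, rfl⟩
    rw [← spectrum.singleton_sub_eq] at hi
    obtain ⟨_, rfl, y, hy, hxy⟩ := hi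
    have : y ≤ specSup M := le_csSup (spectrum_finite M).bddAbove hy
    simp only at hxy
    rw [Pi.zero_apply, ← hxy]
    exact sub_nonneg.2 this
  have := hP.dotProduct_mulVec_nonneg v
  rw [Matrix.sub_mulVec, dotProduct_sub, Algebra.algebraMap_eq_smul_one, Matrix.smul_mulVec,
    Matrix.one_mulVec, dotProduct_smul, smul_eq_mul, star_trivial] at this
  linarith

theorem exists_eigenvector_specSup {M : Matrix (Fin 6) (Fin 6) ℝ} (hM : M.IsHermitian) :
    ∃ v : Fin 6 → ℝ, 0 < v ⬝ᵥ v ∧ v ⬝ᵥ (M *ᵥ v) = specSup M * (v ⬝ᵥ v) := by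
  have h : specSup M ∈ spectrum ℝ M :=
    (spectrum_nonempty_of_isHermitian hM).csSup_mem (spectrum_finite M)
  rw [← Matrix.spectrum_toLin', ← Module.End.hasEigenvalue_iff_mem_spectrum] at h
  obtain ⟨v, hv⟩ := h.exists_hasEigenvector
  refine ⟨v, ?_, ?_⟩
  · have := Matrix.dotProduct_star_self_pos_iff.2 hv.2
    simpa using this
  · have := hv.apply_eq_smul
    rw [Matrix.toLin'_apply] at this
    rw [this, dotProduct_smul, smul_eq_mul]

/-- On a top eigenvector of `L` the Rayleigh quotients of `M` and `N` are at most their largest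
eigenvalues. -/
theorem specSup_add_le {M N L : Matrix (Fin 6) (Fin 6) ℝ} {a b : ℝ} (hM : M.IsHermitian)
    (hN : N.IsHermitian) (hL : L.IsHermitian) (ha : 0 ≤ a) (hb : 0 ≤ b)
    (h : L = a • M + b • N) : specSup L ≤ a * specSup M + b * specSup N := by
  obtain ⟨v, hv, hLv⟩ := exists_eigenvector_specSup hL
  have h1 := mul_le_mul_of_nonneg_left (dotProduct_mulVec_le_specSup hM v) ha
  have h2 := mul_le_mul_of_nonneg_left (dotProduct_mulVec_le_specSup hN v) hb
  rw [h, Matrix.add_mulVec, Matrix.smul_mulVec, Matrix.smul_mulVec, dotProduct_add,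
    dotProduct_smul, dotProduct_smul, smul_eq_mul, smul_eq_mul, ← h] at hLv
  refine le_of_mul_le_mul_right ?_ hv
  linarith

theorem isHermitian_mat0 (f : ℝ → ℝ) (μ β κ γ : ℝ) : (mat0 f μ β κ γ).IsHermitian := by
  ext i j
  fin_cases i <;> fin_cases j <;> rfl

theorem isHermitian_mat1 (f : ℝ → ℝ) (μ β κ γ : ℝ) : (mat1 f μ β κ γ).IsHermitian := by
  ext i j
  fin_cases i <;> fin_cases j <;> rfl

theorem convexOn_boundB (f : ℝ → ℝ) (μ β : ℝ) :
    ConvexOn ℝ Set.univ (fun p : ℝ × ℝ => boundB f μ β p.1 p.2) := by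
  refine ConvexOn.sup (f := fun p : ℝ × ℝ => specSup (mat0 f μ β p.1 p.2))
    (g := fun p : ℝ × ℝ => specSup (mat1 f μ β p.1 p.2)) ?_ ?_
  · refine ⟨convex_univ, fun p _ q _ a b ha hb hab => ?_⟩
    refine specSup_add_le (isHermitian_mat0 _ _ _ _ _) (isHermitian_mat0 _ _ _ _ _)
      (isHermitian_mat0 _ _ _ _ _) ha hb ?_
    -- The matrices are affine, not linear, in (κ, γ): their constant parts match only because the
    -- weights sum to 1.
    obtain rfl : b = 1 - a := by linarith
    ext i j
    fin_cases i <;> fin_cases j <;> simp [mat0] <;> ring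
  · refine ⟨convex_univ, fun p _ q _ a b ha hb hab => ?_⟩
    refine specSup_add_le (isHermitian_mat1 _ _ _ _ _) (isHermitian_mat1 _ _ _ _ _)
      (isHermitian_mat1 _ _ _ _ _) ha hb ?_
    obtain rfl : b = 1 - a := by linarith
    ext i j
    fin_cases i <;> fin_cases j <;> simp [mat1] <;> ring

/-! ### The two blocks -/

/-- The terms `- 0` give the form the shape of `hform` in `two_block_form_le` with γo = 0 and γe =
γ. For `mat1` the two roles are exchanged. -/
theorem dotProduct_mat0_mulVec (f : ℝ → ℝ) (μ β κ γ : ℝ) (v : Fin 6 → ℝ) :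
    v ⬝ᵥ (mat0 f μ β κ γ *ᵥ v) =
      (1 - 0) * v 0 ^ 2 + (1 - 0) * v 1 ^ 2 + (κ * coefO β + lamOO f μ β - 0) * v 2 ^ 2
        + (κ * coefE β + lamEE f μ β - γ) * v 3 ^ 2 + (1 - γ) * v 4 ^ 2 + (1 - γ) * v 5 ^ 2
        + 2 * (delOE f μ β * v 0 * v 3 + sigOO f μ β * v 1 * v 2 + sigOE f μ β * v 1 * v 3
          + (κ * Real.sqrt (coefO β * coefE β) + lamOE f μ β) * v 2 * v 3
          + sigEO f μ β * v 2 * v 4 + sigEE f μ β * v 3 * v 4 + delEE f μ β * v 3 * v 5) := by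
  simp only [mat0, Matrix.mulVec, dotProduct, Fin.sum_univ_six, Matrix.of_apply, Matrix.cons_val]
  ring

theorem dotProduct_mat1_mulVec (f : ℝ → ℝ) (μ β κ γ : ℝ) (v : Fin 6 → ℝ) :
    v ⬝ᵥ (mat1 f μ β κ γ *ᵥ v) =
      (1 - γ) * v 0 ^ 2 + (1 - γ) * v 1 ^ 2 + (κ * coefO β + lamOO f μ β - γ) * v 2 ^ 2
        + (κ * coefE β + lamEE f μ β - 0) * v 3 ^ 2 + (1 - 0) * v 4 ^ 2 + (1 - 0) * v 5 ^ 2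
        + 2 * (delOE f μ β * v 0 * v 3 + sigOO f μ β * v 1 * v 2 + (-sigOE f μ β) * v 1 * v 3
          + (κ * Real.sqrt (coefO β * coefE β) + (-lamOE f μ β)) * v 2 * v 3
          + sigEO f μ β * v 2 * v 4 + (-sigEE f μ β) * v 3 * v 4 + delEE f μ β * v 3 * v 5) := by
  simp only [mat1, Matrix.mulVec, dotProduct, Fin.sum_univ_six, Matrix.of_apply, Matrix.cons_val]
  ring

theorem dotProduct_self_fin_six (v : Fin 6 → ℝ) :
    v ⬝ᵥ v = v 0 ^ 2 + v 1 ^ 2 + v 2 ^ 2 + v 3 ^ 2 + v 4 ^ 2 + v 5 ^ 2 := by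
  simp only [dotProduct, Fin.sum_univ_six]
  ring

namespace IsAcceptance

variable {f : ℝ → ℝ} (hf : IsAcceptance f) (μ β : ℝ)

theorem inner_opEO_left (f : ℝ → ℝ) (μ β : ℝ) (φ ψ : ModeC) :
    inner ℂ (opEO f μ β φ) ψ = inner ℂ φ (opOE f μ β ψ) :=
  ContinuousLinearMap.adjoint_inner_left _ _ _

theorem opOO_projOdd (hf : IsAcceptance f) (ψ : ModeC) :
    opOO f μ β (projOdd ψ) = opOO f μ β ψ := by
  simp only [hf.opOO_eq, ContinuousLinearMap.comp_apply, projOdd_projOdd]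

theorem opOE_projEven (hf : IsAcceptance f) (ψ : ModeC) :
    opOE f μ β (projEven ψ) = opOE f μ β ψ := by
  simp only [hf.opOE_eq, ContinuousLinearMap.comp_apply, projEven_projEven]

theorem opEO_projOdd (hf : IsAcceptance f) (ψ : ModeC) :
    opEO f μ β (projOdd ψ) = opEO f μ β ψ := by
  simp only [hf.opEO_eq, ContinuousLinearMap.comp_apply, projOdd_projOdd]

theorem opEE_projEven (hf : IsAcceptance f) (ψ : ModeC) :
    opEE f μ β (projEven ψ) = opEE f μ β ψ := by
  simp only [hf.opEE_eq, ContinuousLinearMap.comp_apply, projEven_projEven]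

theorem projOdd_opOO (hf : IsAcceptance f) (ψ : ModeC) :
    projOdd (opOO f μ β ψ) = opOO f μ β ψ := by
  simp only [hf.opOO_eq, ContinuousLinearMap.comp_apply, projOdd_projOdd]

theorem projOdd_opOE (hf : IsAcceptance f) (ψ : ModeC) :
    projOdd (opOE f μ β ψ) = opOE f μ β ψ := by
  simp only [hf.opOE_eq, ContinuousLinearMap.comp_apply, projOdd_projOdd]

theorem projEven_opEE (hf : IsAcceptance f) (ψ : ModeC) :
    projEven (opEE f μ β ψ) = opEE f μ β ψ := by
  simp only [hf.opEE_eq, ContinuousLinearMap.comp_apply, projEven_projEven]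

theorem braket_opOO_im (hf : IsAcceptance f) : (braket β (opOO f μ β)).im = 0 :=
  (isRealWave_coherentState β).inner_im (hf.isRealWave_opOO μ β (isRealWave_coherentState β))

theorem braket_opEE_im (hf : IsAcceptance f) : (braket β (opEE f μ β)).im = 0 :=
  (isRealWave_coherentState β).inner_im (hf.isRealWave_opEE μ β (isRealWave_coherentState β))

theorem braket_opOE_im (hf : IsAcceptance f) : (braket β (opOE f μ β)).im = 0 :=
  (isRealWave_coherentState β).inner_im (hf.isRealWave_opOE μ β (isRealWave_coherentState β))

theorem braket_opOO_opOE_im (hf : IsAcceptance f) :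
    (braket β (opOO f μ β ∘L opOE f μ β)).im = 0 :=
  (isRealWave_coherentState β).inner_im
    (hf.isRealWave_opOO μ β (hf.isRealWave_opOE μ β (isRealWave_coherentState β)))

theorem braket_opOE_opEE_im (hf : IsAcceptance f) :
    (braket β (opOE f μ β ∘L opEE f μ β)).im = 0 :=
  (isRealWave_coherentState β).inner_im
    (hf.isRealWave_opOE μ β (hf.isRealWave_opEE μ β (isRealWave_coherentState β)))

/-- With `p` and `k` the normalized odd and even parts of the coherent state, the λ, σ and Δ are
exactly the Gram-Schmidt coefficients of the images of `p` and `k`: one frame of odd vectors, one of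
even vectors. Reality of the matrix elements lets the real parts in the definitions stand for the
inner products. -/
theorem blocks_le_specSup (hf : IsAcceptance f) {β : ℝ} (hβ : 0 < β) (κ γ : ℝ) (o e : ModeC) :
    (inner ℂ o (opOO f μ β o)).re + 2 * (inner ℂ o (opOE f μ β e)).re
        + (inner ℂ e (opEE f μ β e)).re
        + κ * ‖inner ℂ (projOdd (coherentState β)) o
          + inner ℂ (projEven (coherentState β)) e‖ ^ 2
        - γ * ‖e‖ ^ 2 ≤ specSup (mat0 f μ β κ γ) * (‖o‖ ^ 2 + ‖e‖ ^ 2) ∧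
    (inner ℂ o (opOO f μ β o)).re - 2 * (inner ℂ o (opOE f μ β e)).re
        + (inner ℂ e (opEE f μ β e)).re
        + κ * ‖inner ℂ (projOdd (coherentState β)) o
          + inner ℂ (projEven (coherentState β)) e‖ ^ 2
        - γ * ‖o‖ ^ 2 ≤ specSup (mat1 f μ β κ γ) * (‖o‖ ^ 2 + ‖e‖ ^ 2) := by
  have hCo := coefO_pos hβ
  have hCe := coefE_pos β
  obtain ⟨a, ha⟩ : ∃ a, a = Real.sqrt (coefO β) := ⟨_, rfl⟩
  obtain ⟨b, hb⟩ : ∃ b, b = Real.sqrt (coefE β) := ⟨_, rfl⟩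
  have ha0 : 0 < a := ha ▸ Real.sqrt_pos.2 hCo
  have hb0 : 0 < b := hb ▸ Real.sqrt_pos.2 hCe
  have ha2 : a ^ 2 = coefO β := by rw [ha, Real.sq_sqrt hCo.le]
  have hb2 : b ^ 2 = coefE β := by rw [hb, Real.sq_sqrt hCe.le]
  have hab : Real.sqrt (coefO β * coefE β) = a * b := by rw [ha, hb, Real.sqrt_mul hCo.le]
  have hac : (a : ℂ) ≠ 0 := by exact_mod_cast ha0.ne'
  have hbc : (b : ℂ) ≠ 0 := by exact_mod_cast hb0.ne'
  set φ := coherentState β with hφ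
  have reals : ∀ {z : ℂ}, z.im = 0 → z = (z.re : ℂ) := fun h => Complex.ext rfl (by simpa using h)
  obtain ⟨p, hpd⟩ : ∃ p, p = ((a⁻¹ : ℝ) : ℂ) • projOdd φ := ⟨_, rfl⟩
  obtain ⟨k, hkd⟩ : ∃ k, k = ((b⁻¹ : ℝ) : ℂ) • projEven φ := ⟨_, rfl⟩
  have hp : ‖p‖ = 1 := by
    have h1 := norm_sq_projOdd_coherentState β
    rw [← ha2, sq_eq_sq₀ (norm_nonneg _) ha0.le] at h1
    rw [hpd, norm_smul, h1, Complex.norm_real, Real.norm_of_nonneg (inv_pos.2 ha0).le,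
      inv_mul_cancel₀ ha0.ne']
  have hk : ‖k‖ = 1 := by
    have h1 := norm_sq_projEven_coherentState β
    rw [← hb2, sq_eq_sq₀ (norm_nonneg _) hb0.le] at h1
    rw [hkd, norm_smul, h1, Complex.norm_real, Real.norm_of_nonneg (inv_pos.2 hb0).le,
      inv_mul_cancel₀ hb0.ne']
  have hpi : ∀ ψ, inner ℂ p ψ = ((a⁻¹ : ℝ) : ℂ) * inner ℂ (projOdd φ) ψ := fun ψ => by
    rw [hpd, inner_smul_left, Complex.conj_ofReal]
  have hki : ∀ ψ, inner ℂ k ψ = ((b⁻¹ : ℝ) : ℂ) * inner ℂ (projEven φ) ψ := fun ψ => by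
    rw [hkd, inner_smul_left, Complex.conj_ofReal]
  have hAp : opOO f μ β p = ((a⁻¹ : ℝ) : ℂ) • opOO f μ β φ := by
    rw [hpd, map_smul, hf.opOO_projOdd]
  have hBk : opOE f μ β k = ((b⁻¹ : ℝ) : ℂ) • opOE f μ β φ := by
    rw [hkd, map_smul, hf.opOE_projEven]
  have hBp : opEO f μ β p = ((a⁻¹ : ℝ) : ℂ) • opEO f μ β φ := by
    rw [hpd, map_smul, hf.opEO_projOdd]
  have hDk : opEE f μ β k = ((b⁻¹ : ℝ) : ℂ) • opEE f μ β φ := by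
    rw [hkd, map_smul, hf.opEE_projEven]
  have hnorm : ∀ (t : ℝ) (ψ : ModeC), ‖((t⁻¹ : ℝ) : ℂ) • ψ‖ ^ 2 = (t ^ 2)⁻¹ * ‖ψ‖ ^ 2 := by
    intro t ψ
    rw [norm_smul, mul_pow, Complex.norm_real, Real.norm_eq_abs, sq_abs, inv_pow]
  have i1 : inner ℂ p (opOO f μ β p) = (lamOO f μ β : ℂ) := by
    rw [hpi, hAp, inner_smul_right, inner_projOdd_left, hf.projOdd_opOO, lamOO,
      Complex.ofReal_mul, ← reals (hf.braket_opOO_im μ β), braket, ← ha2]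
    push_cast
    ring
  have i2 : inner ℂ p (opOE f μ β k) = (lamOE f μ β : ℂ) := by
    rw [hpi, hBk, inner_smul_right, inner_projOdd_left, hf.projOdd_opOE, lamOE,
      Complex.ofReal_mul, ← reals (hf.braket_opOE_im μ β), braket, hab]
    push_cast
    ring
  have i3 : inner ℂ k (opEO f μ β p) = (lamOE f μ β : ℂ) := by
    rw [← inner_conj_symm, inner_opEO_left, i2, Complex.conj_ofReal]
  have i4 : inner ℂ k (opEE f μ β k) = (lamEE f μ β : ℂ) := by
    rw [hki, hDk, inner_smul_right, inner_projEven_left, hf.projEven_opEE, lamEE,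
      Complex.ofReal_mul, ← reals (hf.braket_opEE_im μ β), braket, ← hb2]
    push_cast
    ring
  have i5 : inner ℂ (opOO f μ β p) (opOE f μ β k) = (((Real.sqrt (coefO β * coefE β))⁻¹ *
      (braket β (opOO f μ β ∘L opOE f μ β)).re : ℝ) : ℂ) := by
    rw [hf.inner_opOO_left, hpi, hBk, map_smul, inner_smul_right, inner_projOdd_left,
      hf.projOdd_opOO, Complex.ofReal_mul, ← reals (hf.braket_opOO_opOE_im μ β), braket, hab,
      ContinuousLinearMap.comp_apply]
    push_cast
    ring
  have i6 : inner ℂ (opEO f μ β p) (opEE f μ β k) = (((Real.sqrt (coefO β * coefE β))⁻¹ *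
      (braket β (opOE f μ β ∘L opEE f μ β)).re : ℝ) : ℂ) := by
    rw [inner_opEO_left, hpi, hDk, map_smul, inner_smul_right, inner_projOdd_left,
      hf.projOdd_opOE, Complex.ofReal_mul, ← reals (hf.braket_opOE_opEE_im μ β), braket, hab,
      ContinuousLinearMap.comp_apply]
    push_cast
    ring
  obtain ⟨u₁, u₂, eA, eB, hu₁, hu₂, hbo⟩ := exists_gramSchmidt_frame (σ := sigOO f μ β)
    (s := sigOE f μ β) (δ := delOE f μ β) hp i1 i2 i5
    (by rw [sigOO, hAp, hnorm, ha2]) (by rw [sigOE]) (by rw [delOE, hBk, hnorm, hb2])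
  obtain ⟨w₁, w₂, eC, eD, hw₁, hw₂, hbe⟩ := exists_gramSchmidt_frame (σ := sigEO f μ β)
    (s := sigEE f μ β) (δ := delEE f μ β) hk i3 i4 i6
    (by rw [sigEO, hBp, hnorm, ha2]) (by rw [sigEE]) (by rw [delEE, hDk, hnorm, hb2])
  have hpo : (a : ℂ) * inner ℂ p o = inner ℂ (projOdd φ) o := by
    rw [hpi, Complex.ofReal_inv, mul_inv_cancel_left₀ hac]
  have hke : (b : ℂ) * inner ℂ k e = inner ℂ (projEven φ) e := by
    rw [hki, Complex.ofReal_inv, mul_inv_cancel_left₀ hbc]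
  constructor
  · have h := two_block_form_le (hf.inner_opOO_left μ β) (inner_opEO_left f μ β)
      (hf.inner_opEE_left μ β) (hf.block_le μ β) hp hk eA eB eC eD hu₁ hu₂ hw₁ hw₂ hbo hbe
      (κ := κ) (γo := 0) (γe := γ) (a := a) (b := b) (c := specSup (mat0 f μ β κ γ))
      (fun v => by
        have := dotProduct_mulVec_le_specSup (isHermitian_mat0 f μ β κ γ) v
        rwa [dotProduct_mat0_mulVec, dotProduct_self_fin_six, ← ha2, ← hb2,
          Real.sqrt_mul (sq_nonneg a), Real.sqrt_sq ha0.le, Real.sqrt_sq hb0.le] at this) o e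
    rw [hpo, hke] at h
    linarith
  -- The second block has the opposite coupling and reuses the same frames. Negating `u₂` and `w₁`
  -- keeps the signs of Δ_oe and σ_eo, so that only λ_oe, σ_oe and σ_ee change sign, as in `mat1`.
  · have h := two_block_form_le (B := -opOE f μ β) (B' := -opEO f μ β) (u₁ := u₁) (u₂ := -u₂)
      (w₁ := -w₁) (w₂ := w₂) (loe := -lamOE f μ β) (soe := -sigOE f μ β) (see := -sigEE f μ β)
      (hf.inner_opOO_left μ β) (fun x y => by simp [inner_opEO_left])
      -- The bound by the identity is insensitive to the sign of the coupling: replace `e` by `-e`.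
      (hf.inner_opEE_left μ β) (fun o e => by
        have := hf.block_le μ β o (-e)
        simpa using this) hp hk eA
      (by
        rw [neg_apply, eB]
        push_cast
        module)
      (by
        rw [neg_apply, eC]
        push_cast
        module)
      (by
        rw [eD]
        push_cast
        module)
      hu₁ (by simpa using hu₂) (by simpa using hw₁) hw₂
      (fun v => by simpa using hbo v) (fun v => by simpa using hbe v)
      (κ := κ) (γo := γ) (γe := 0) (a := a) (b := b) (c := specSup (mat1 f μ β κ γ))
      (fun v => by
        have := dotProduct_mulVec_le_specSup (isHermitian_mat1 f μ β κ γ) v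
        rwa [dotProduct_mat1_mulVec, dotProduct_self_fin_six, ← ha2, ← hb2,
          Real.sqrt_mul (sq_nonneg a), Real.sqrt_sq ha0.le, Real.sqrt_sq hb0.le] at this) o e
    rw [hpo, hke] at h
    simp only [neg_apply, inner_neg_right, Complex.neg_re] at h
    linarith

end IsAcceptance

/-! ### The operator on the joint system -/

theorem tensorAC_apply (P : Matrix (Fin 2) (Fin 2) ℂ) (T : ModeC →L[ℂ] ModeC) (ψ : SpaceAC)
    (i : Fin 2) : tensorAC P T ψ i = P i 0 • T (ψ 0) + P i 1 • T (ψ 1) := by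
  simp [tensorAC, Fin.sum_univ_two]

theorem inner_tensorAC (P : Matrix (Fin 2) (Fin 2) ℂ) (T : ModeC →L[ℂ] ModeC) (φ ψ : SpaceAC) :
    inner ℂ φ (tensorAC P T ψ) = P 0 0 * inner ℂ (φ 0) (T (ψ 0))
      + P 0 1 * inner ℂ (φ 0) (T (ψ 1)) + P 1 0 * inner ℂ (φ 1) (T (ψ 0))
      + P 1 1 * inner ℂ (φ 1) (T (ψ 1)) := by
  rw [PiLp.inner_apply, Fin.sum_univ_two, tensorAC_apply, tensorAC_apply, inner_add_right,
    inner_add_right, inner_smul_right, inner_smul_right, inner_smul_right, inner_smul_right]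
  ring

theorem inner_rankOne_self (φ ψ : ModeC) :
    inner ℂ ψ (InnerProductSpace.rankOne ℂ φ φ ψ) = ((‖inner ℂ φ ψ‖ ^ 2 : ℝ) : ℂ) := by
  rw [InnerProductSpace.rankOne_apply, inner_smul_right, ← inner_conj_symm ψ φ, RCLike.mul_conj]
  push_cast
  rfl

theorem inner_projTrash (ψ : SpaceAC) :
    inner ℂ ψ (projTrash ψ) = ((1 / 2 * ‖minusMap ψ‖ ^ 2 : ℝ) : ℂ) := by
  have h : ((‖minusMap ψ‖ ^ 2 : ℝ) : ℂ) = inner ℂ (minusMap ψ) (minusMap ψ) := by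
    rw [inner_self_eq_norm_sq_to_K]
    push_cast
    rfl
  rw [Complex.ofReal_mul, h, projTrash, inner_tensorAC, dyad_ketMinus, minusMap_apply]
  simp only [inner_sub_left, inner_sub_right, ContinuousLinearMap.id_apply, Matrix.of_apply,
    Matrix.cons_val]
  push_cast
  ring

/-- |-β⟩ is the mirror image of |β⟩, so its odd part has the opposite sign. The parallelogram law
for the amplitudes ⟨β|ψ 0⟩ and ⟨-β|ψ 1⟩ then sorts the fidelity into one square for each block. -/
theorem inner_projFid (β : ℝ) (ψ : SpaceAC) :
    inner ℂ ψ (projFid β ψ) = ((1 / 2 *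
      (‖inner ℂ (projOdd (coherentState β)) (plusMap ψ)
        + inner ℂ (projEven (coherentState β)) (minusMap ψ)‖ ^ 2
      + ‖inner ℂ (projOdd (coherentState β)) (minusMap ψ)
        + inner ℂ (projEven (coherentState β)) (plusMap ψ)‖ ^ 2) : ℝ) : ℂ) := by
  have h : inner ℂ ψ (projFid β ψ) = ((‖inner ℂ (coherentState β) (ψ 0)‖ ^ 2
      + ‖inner ℂ (coherentState (-β)) (ψ 1)‖ ^ 2 : ℝ) : ℂ) := by
    rw [projFid, add_apply, inner_add_right, inner_tensorAC, inner_tensorAC, dyad_ket0, dyad_ket1]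
    simp only [inner_rankOne_self]
    simp
  have e1 : coherentState β = projOdd (coherentState β) + projEven (coherentState β) :=
    (projOdd_add_projEven _).symm
  have e2 : coherentState (-β) = projEven (coherentState β) - projOdd (coherentState β) := by
    rw [projOdd_apply, projEven_apply, parity_coherentState]
    module
  rw [h, plusMap_apply, minusMap_apply, e2]
  nth_rewrite 1 [e1]
  simp only [inner_add_left, inner_sub_left, inner_add_right, inner_sub_right]
  generalize inner ℂ (projOdd (coherentState β)) (ψ 0) = z₁
  generalize inner ℂ (projOdd (coherentState β)) (ψ 1) = z₂
  generalize inner ℂ (projEven (coherentState β)) (ψ 0) = z₃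
  generalize inner ℂ (projEven (coherentState β)) (ψ 1) = z₄
  congr 1
  simp only [Complex.sq_norm, Complex.normSq_apply, Complex.add_re, Complex.add_im,
    Complex.sub_re, Complex.sub_im]
  ring

theorem IsAcceptance.inner_blockSum {f : ℝ → ℝ} (hf : IsAcceptance f) (μ β : ℝ) (ψ : SpaceAC) :
    inner ℂ ψ (blockSum f μ β ψ) =
      (((inner ℂ (plusMap ψ) (opOO f μ β (plusMap ψ))).re
        + 2 * (inner ℂ (plusMap ψ) (opOE f μ β (minusMap ψ))).re
        + (inner ℂ (minusMap ψ) (opEE f μ β (minusMap ψ))).re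
        + ((inner ℂ (minusMap ψ) (opOO f μ β (minusMap ψ))).re
        - 2 * (inner ℂ (minusMap ψ) (opOE f μ β (plusMap ψ))).re
        + (inner ℂ (plusMap ψ) (opEE f μ β (plusMap ψ))).re) : ℝ) : ℂ) := by
  have hreal : ∀ {T : ModeC →L[ℂ] ModeC}, (∀ x y, inner ℂ (T x) y = inner ℂ x (T y)) →
      ∀ φ, ((inner ℂ φ (T φ)).re : ℂ) = inner ℂ φ (T φ) := fun hT φ => by
    rw [← Complex.conj_eq_iff_re, inner_conj_symm, hT]
  have heo : ∀ φ χ, inner ℂ φ (opEO f μ β χ) + inner ℂ χ (opOE f μ β φ) =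
      2 * ((inner ℂ χ (opOE f μ β φ)).re : ℂ) := fun φ χ => by
    rw [← inner_conj_symm, IsAcceptance.inner_opEO_left, add_comm, Complex.add_conj]
    push_cast
    ring
  have h1 := heo (minusMap ψ) (plusMap ψ)
  have h2 := heo (plusMap ψ) (minusMap ψ)
  push_cast
  rw [hreal (hf.inner_opOO_left μ β), hreal (hf.inner_opEE_left μ β),
    hreal (hf.inner_opOO_left μ β), hreal (hf.inner_opEE_left μ β), ← h1, ← h2]
  simp only [blockSum, add_apply, smul_apply, ContinuousLinearMap.comp_apply, inner_add_right,
    inner_smul_right, ContinuousLinearMap.adjoint_inner_right]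
  ring

theorem inner_projOdd_projOdd (φ ψ : ModeC) :
    inner ℂ (projOdd φ) (projOdd ψ) = inner ℂ (projOdd φ) ψ := by
  rw [← inner_projOdd_left, projOdd_projOdd]

theorem inner_projEven_projEven (φ ψ : ModeC) :
    inner ℂ (projEven φ) (projEven ψ) = inner ℂ (projEven φ) ψ := by
  rw [← inner_projEven_left, projEven_projEven]

theorem IsAcceptance.opM_le {f : ℝ → ℝ} (hf : IsAcceptance f) {μ β : ℝ} (hβ : 0 < β)
    (hβμ : β ^ 2 < μ) (κ γ : ℝ) :
    opM f μ β κ γ ≤ (boundB f μ β κ γ : ℂ) • ContinuousLinearMap.id ℂ SpaceAC := by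
  rw [ContinuousLinearMap.le_def, ContinuousLinearMap.isPositive_iff_complex]
  intro ψ
  obtain ⟨t, ht, ht0⟩ : ∃ t : ℝ, inner ℂ ψ (((boundB f μ β κ γ : ℂ) •
      ContinuousLinearMap.id ℂ SpaceAC - opM f μ β κ γ) ψ) = (t : ℂ) ∧ 0 ≤ t := by
    rw [sub_apply, smul_apply, ContinuousLinearMap.id_apply, opM, sub_apply, add_apply,
      smul_apply, smul_apply, hf.phaseErrorOp_eq hβμ, smul_apply, inner_sub_right, inner_sub_right,
      inner_add_right, inner_smul_right, inner_smul_right, inner_smul_right, inner_smul_right,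
      hf.inner_blockSum, inner_projFid, inner_projTrash, inner_self_eq_norm_sq_to_K]
    generalize hP : plusMap ψ = P
    generalize hN : minusMap ψ = N
    refine ⟨boundB f μ β κ γ * ‖ψ‖ ^ 2 - (1 / 2 * ((inner ℂ P (opOO f μ β P)).re
        + 2 * (inner ℂ P (opOE f μ β N)).re + (inner ℂ N (opEE f μ β N)).re
        + ((inner ℂ N (opOO f μ β N)).re - 2 * (inner ℂ N (opOE f μ β P)).re
        + (inner ℂ P (opEE f μ β P)).re))
      + κ * (1 / 2 * (‖inner ℂ (projOdd (coherentState β)) P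
          + inner ℂ (projEven (coherentState β)) N‖ ^ 2
        + ‖inner ℂ (projOdd (coherentState β)) N
          + inner ℂ (projEven (coherentState β)) P‖ ^ 2))
      - γ * (1 / 2 * ‖N‖ ^ 2)), ?_, ?_⟩
    · push_cast
      rfl
    -- Each of the four sectors of `P` and `N` is used once, so the right-hand norms add up to the
    -- full norm. The two trash terms, with the even and the odd part of `N`, combine to γ‖N‖².
    have h0 := (hf.blocks_le_specSup μ hβ κ γ (projOdd P) (projEven N)).1
    have h1 := (hf.blocks_le_specSup μ hβ κ γ (projOdd N) (projEven P)).2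
    have hoo : ∀ φ χ, inner ℂ (projOdd φ) (opOO f μ β χ) = inner ℂ φ (opOO f μ β χ) :=
      fun φ χ => by rw [inner_projOdd_left, hf.projOdd_opOO]
    have hoe : ∀ φ χ, inner ℂ (projOdd φ) (opOE f μ β χ) = inner ℂ φ (opOE f μ β χ) :=
      fun φ χ => by rw [inner_projOdd_left, hf.projOdd_opOE]
    have hee : ∀ φ χ, inner ℂ (projEven φ) (opEE f μ β χ) = inner ℂ φ (opEE f μ β χ) :=
      fun φ χ => by rw [inner_projEven_left, hf.projEven_opEE]
    simp only [hf.opOO_projOdd, hf.opOE_projEven, hf.opEE_projEven, inner_projOdd_projOdd,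
      inner_projEven_projEven, hoo, hoe, hee] at h0 h1
    have hB0 : specSup (mat0 f μ β κ γ) ≤ boundB f μ β κ γ := le_max_left _ _
    have hB1 : specSup (mat1 f μ β κ γ) ≤ boundB f μ β κ γ := le_max_right _ _
    have g0 := mul_le_mul_of_nonneg_right hB0
      (by positivity : 0 ≤ ‖projOdd P‖ ^ 2 + ‖projEven N‖ ^ 2)
    have g1 := mul_le_mul_of_nonneg_right hB1
      (by positivity : 0 ≤ ‖projOdd N‖ ^ 2 + ‖projEven P‖ ^ 2)
    have n1 := norm_sq_projOdd_add_norm_sq_projEven P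
    have n2 := norm_sq_projOdd_add_norm_sq_projEven N
    have n3 := norm_sq_plusMap_add_norm_sq_minusMap ψ
    rw [hP, hN, ← n1, ← n2] at n3
    -- The factor 1/2 arises because `plusMap` and `minusMap` carry the factor √2.
    have n4 : ‖ψ‖ ^ 2 = 1 / 2 * (‖projOdd P‖ ^ 2 + ‖projEven P‖ ^ 2 +
        (‖projOdd N‖ ^ 2 + ‖projEven N‖ ^ 2)) := by linarith
    rw [n4, ← n2]
    linarith
  have hsymm : inner ℂ (((boundB f μ β κ γ : ℂ) •
      ContinuousLinearMap.id ℂ SpaceAC - opM f μ β κ γ) ψ) ψ = (t : ℂ) := by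
    rw [← inner_conj_symm, ht, Complex.conj_ofReal]
  rw [hsymm]
  exact ⟨by simp, by simpa using ht0⟩

end

end HomodyneQKD

/-! ### The main theorem -/

open HomodyneQKD
/-- Operator inequality for the Homodyne protocol. The first block of conclusions says that the
operator integrals in the definitions exist and that the parameters are real, with the stated
values of the two squared norms. -/
theorem mainTheorem2 (f : ℝ → ℝ) (hf_meas : Measurable f) (hf_nonneg : ∀ x, 0 ≤ f x)
    (hf_le : ∀ x, f x + f (-x) ≤ 1) (μ β : ℝ) (hβ : 0 < β) (hβμ : β < Real.sqrt μ) :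
    (IsOpIntegral (phaseErrorForm f μ β) (phaseErrorOp f μ β) ∧
      IsOpIntegral (formOO f μ β) (opOO f μ β) ∧
      IsOpIntegral (formEE f μ β) (opEE f μ β) ∧
      IsOpIntegral (formOE f μ β) (opOE f μ β) ∧
      IsOpIntegral (formOE' f μ β) (opOE' f μ β) ∧
      opOE' f μ β = -opOE f μ β ∧
      braket β projOdd = ((Real.exp (-β ^ 2) * Real.sinh (β ^ 2) : ℝ) : ℂ) ∧
      braket β projEven = ((Real.exp (-β ^ 2) * Real.cosh (β ^ 2) : ℝ) : ℂ) ∧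
      (braket β (opOO f μ β)).im = 0 ∧
      (braket β (opEE f μ β)).im = 0 ∧
      (braket β (opOE f μ β)).im = 0 ∧
      (braket β (opOO f μ β ∘L opOE f μ β)).im = 0 ∧
      (braket β (opOE f μ β ∘L opEE f μ β)).im = 0) ∧
    ConvexOn ℝ Set.univ (fun p : ℝ × ℝ => boundB f μ β p.1 p.2) ∧
    ∀ κ γ : ℝ, 0 ≤ κ → 0 ≤ γ →
      opM f μ β κ γ ≤ (boundB f μ β κ γ : ℂ) • ContinuousLinearMap.id ℂ SpaceAC := by
  have hf : IsAcceptance f := ⟨hf_meas, hf_nonneg, hf_le⟩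
  have hβμ' : β ^ 2 < μ := (Real.lt_sqrt hβ.le).1 hβμ
  refine ⟨⟨(hf.isOpIntegral_phaseErrorForm hβμ').isOpIntegral_opIntegral,
    hf.isOpIntegral_opOO μ β, hf.isOpIntegral_opEE μ β, hf.isOpIntegral_opOE μ β,
    (hf.isOpIntegral_neg_opOE μ β).isOpIntegral_opIntegral,
    (hf.isOpIntegral_neg_opOE μ β).opIntegral_eq, braket_projOdd β, braket_projEven β,
    hf.braket_opOO_im μ β, hf.braket_opEE_im μ β, hf.braket_opOE_im μ β,
    hf.braket_opOO_opOE_im μ β, hf.braket_opOE_opEE_im μ β⟩, convexOn_boundB f μ β,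
    fun κ γ _ _ => hf.opM_le hβ hβμ' κ γ⟩
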